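/- Let $N\ge 2$, $1<p<\infty$, $N<q<\infty$, $N<r<\infty$, and let $\Omega\subset\mathbb R^N$ be a uniform $W^{2-1/r}_r$ domain, i.e. a (nonempty, open, connected) domain for which there are $\alpha,\beta,K>0$ such that for every $x_0\in\partial\Omega$ there are a coordinate index $j$ and a function $h$ of $x'=(x_1,\dots,\widehat{x_j},\dots,x_N)$ on the ball $B'_\alpha(x_0')$ with $\|h\|_{W^{2-1/r}_r(B'_\alpha(x_0'))}\le K$, $$\Omega\cap B_\beta(x_0)=\{x: x'\in B'_\alpha(x_0'),\ x_j>h(x')\}\cap B_\beta(x_0),\qquad \partial\Omega\cap B_\beta(x_0)=\{x: x'\in B'_\alpha(x_0'),\ x_j=h(x')\}\cap B_\beta(x_0),$$ where $W^{2-1/r}_r(D)$ is the real interpolation space $(L_r(D),W^2_r(D))_{1-1/(2r),\,r}$. Let $(1-\Delta)^{-1/2}$ be the Fourier multiplier with symbol $(1+|\xi|^2)^{-1/2}$ (with respect to $\mathcal F[f](\xi)=\int e^{-ix\cdot\xi}f(x)\,dx$). Let $\iota:L_{1,\rm loc}(\Omega)\to L_{1,\rm loc}(\mathbb R^N)$ be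 a linear map (real-valued functions) such that for every $1<s<\infty$ there is a constant $C_s$ with * (e-1) $\iota u=u$ a.e. in $\Omega$ for $u\in W^1_s(\Omega)$, and for $m=0,1$ (with $W^0_s=L_s$) and $u\in W^m_s(\Omega)$: $\iota u\in W^m_s(\mathbb R^N)$ and $\|\iota u\|_{W^m_s(\mathbb R^N)}\le C_s\|u\|_{W^m_s(\Omega)}$; * (e-2) $\|(1-\Delta)^{-1/2}\iota(\partial_i u)\|_{L_s(\mathbb R^N)}\le C_s\|u\|_{L_s(\Omega)}$ for $u\in W^1_s(\Omega)$, $i=1,\dots,N$. Then there is a constant $C$, depending only on $N,p,q,r,\Omega,\iota$, such that the following holds for every $0<T<\infty$. Let $a,a',b,b'\in[1,\infty]$ with $\frac1a+\frac1{a'}=1$, $\frac1b+\frac1{b'}=1$, and let $f,g$ be scalar functions with $$f\in L_b((0,T),W^1_q(\Omega)),\quad \partial_tf\in L_a((0,T),L_q(\Omega)),\quad g\in L_{a'}((0,T),W^1_q(\Omega)),\quad \partial_tg\in L_{b'}((0,T),L_q(\Omega)),$$ the time derivatives being weak derivatives of $L_q(\Omega)$-valued functions. Then $(1-\Delta)^{-1/2}\iota((\nabla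 f)g)(t)\in L_q(\mathbb R^N)^N$ for a.e. $t\in(0,T)$; as an $L_q(\mathbb R^N)^N$-valued function of $t$ it is locally integrable on $(0,T)$ and has a locally integrable weak derivative there, and $$\|\partial_t[(1-\Delta)^{-1/2}\iota((\nabla f)g)]\|_{L_p((0,T),L_q(\mathbb R^N))}\le C\Bigl\{\Bigl(\int_0^T\bigl(\|\partial_tf(\cdot,t)\|_{L_q(\Omega)}\|g(\cdot,t)\|_{W^1_q(\Omega)}\bigr)^p\,dt\Bigr)^{1/p}+\Bigl(\int_0^T\bigl(\|\nabla f(\cdot,t)\|_{L_q(\Omega)}\|\partial_tg(\cdot,t)\|_{L_q(\Omega)}\bigr)^p\,dt\Bigr)^{1/p}\Bigr\}$$ (with values in $[0,\infty]$; if the right-hand side is finite, so is the left-hand side). -/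

import Mathlib

open MeasureTheory Set
open scoped ENNReal NNReal SchwartzMap

noncomputable section

namespace FreeBoundary

section Sobolev

variable {κ : Type*} [Fintype κ] [DecidableEq κ]

/-- `φ ∈ C₀^∞(D)`. -/
def IsTestFunction {X : Type*} [NormedAddCommGroup X] [NormedSpace ℝ X]
    (D : Set X) (φ : X → ℝ) : Prop :=
  ContDiff ℝ ((⊤ : ℕ∞) : WithTop ℕ∞) φ ∧ HasCompactSupport φ ∧ tsupport φ ⊆ D

/-- `v` is the weak partial derivative `∂ᵢ u` in the open set `D`. -/
def HasWeakPartial (D : Set (EuclideanSpace ℝ κ)) (i : κ)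
    (u v : EuclideanSpace ℝ κ → ℝ) : Prop :=
  LocallyIntegrableOn u D volume ∧ LocallyIntegrableOn v D volume ∧
    ∀ φ : EuclideanSpace ℝ κ → ℝ, IsTestFunction D φ →
      ∫ x in D, u x * fderiv ℝ φ x (EuclideanSpace.single i 1) = - ∫ x in D, v x * φ x

/-- The norm of `W^m_q(D)`, as the sum of the `L_q(D)`-norms of the weak derivatives up to order
`m`; it is finite exactly on `W^m_q(D)` (weak derivatives are unique almost everywhere, so
the infimum runs over at most one class of functions, and is `∞` if there is none). -/
def sobolevNorm (D : Set (EuclideanSpace ℝ κ)) (q : ℝ≥0∞) :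
    ℕ → (EuclideanSpace ℝ κ → ℝ) → ℝ≥0∞
  | 0, u => ⨅ _ : AEStronglyMeasurable u (volume.restrict D), eLpNorm u q (volume.restrict D)
  | m + 1, u => sobolevNorm D q 0 u +
      ⨅ (G : κ → EuclideanSpace ℝ κ → ℝ) (_ : ∀ i, HasWeakPartial D i u (G i)),
        ∑ i, sobolevNorm D q m (G i)

/-- Peetre's `K`-functional of the couple `(L_r(D), W^2_r(D))`. -/
def kFunctional (D : Set (EuclideanSpace ℝ κ)) (r : ℝ≥0∞) (s : ℝ)
    (h : EuclideanSpace ℝ κ → ℝ) : ℝ≥0∞ :=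
  ⨅ b : EuclideanSpace ℝ κ → ℝ,
    sobolevNorm D r 0 (h - b) + ENNReal.ofReal s * sobolevNorm D r 2 b

/-- The norm of the real interpolation space `(L_r(D), W^2_r(D))_{θ,r} = W^{2θ}_r(D)`. -/
def interpolationNorm (D : Set (EuclideanSpace ℝ κ)) (r : ℝ≥0∞) (θ : ℝ)
    (h : EuclideanSpace ℝ κ → ℝ) : ℝ≥0∞ :=
  (∫⁻ s in Ioi (0 : ℝ),
    (ENNReal.ofReal (s ^ (-θ)) * kFunctional D r s h) ^ r.toReal * ENNReal.ofReal s⁻¹)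
      ^ (1 / r.toReal)

end Sobolev

/-- `x' = (x₁, …, x̂ⱼ, …, x_N)`. -/
def dropCoord {N : ℕ} (j : Fin N) (x : EuclideanSpace ℝ (Fin N)) :
    EuclideanSpace ℝ {i : Fin N // i ≠ j} :=
  WithLp.toLp 2 fun i => x i

/-- Uniform `W^{2-1/r}_r` domains; `W^{2-1/r}_r = W^{2θ}_r` with `θ = 1 - 1/(2r)`. -/
structure IsUniformDomain {N : ℕ} (r : ℝ≥0∞) (Ω : Set (EuclideanSpace ℝ (Fin N))) : Prop where
  isOpen : IsOpen Ω
  isConnected : IsConnected Ω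
  boundary : ∃ α β K : ℝ, 0 < α ∧ 0 < β ∧ 0 < K ∧ ∀ x₀ ∈ frontier Ω,
    ∃ (j : Fin N) (h : EuclideanSpace ℝ {i : Fin N // i ≠ j} → ℝ),
      interpolationNorm (Metric.ball (dropCoord j x₀) α) r (1 - 1 / (2 * r.toReal)) h
        ≤ ENNReal.ofReal K ∧
      Ω ∩ Metric.ball x₀ β =
        {x | dropCoord j x ∈ Metric.ball (dropCoord j x₀) α ∧ h (dropCoord j x) < x j}
          ∩ Metric.ball x₀ β ∧
      frontier Ω ∩ Metric.ball x₀ β =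
        {x | dropCoord j x ∈ Metric.ball (dropCoord j x₀) α ∧ x j = h (dropCoord j x)}
          ∩ Metric.ball x₀ β

section Bessel

variable {N : ℕ}

/-- The symbol `(1 + |ξ|²)^{-1/2}` of `(1 - Δ)^{-1/2}`. The frequency variable of Mathlib's
Fourier transform `∫ e^{-2πi x·ξ} f(x) dx` is rescaled by `2π`. -/
def besselSymbol (ξ : EuclideanSpace ℝ (Fin N)) : ℂ :=
  (((1 + ‖(2 * Real.pi) • ξ‖ ^ 2) ^ (-(1 / 2) : ℝ) : ℝ) : ℂ)

theorem besselSymbol_hasTemperateGrowth :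
    Function.HasTemperateGrowth (besselSymbol (N := N)) := by
  have h : Function.HasTemperateGrowth
      fun ξ : EuclideanSpace ℝ (Fin N) => (((1 + ‖ξ‖ ^ 2) ^ (-(1 / 2) : ℝ) : ℝ) : ℂ) := by
    fun_prop
  have h2 : Function.HasTemperateGrowth
      fun ξ : EuclideanSpace ℝ (Fin N) => (2 * Real.pi) • ξ := by
    fun_prop
  exact h.comp h2

/-- `(1 - Δ)^{-1/2}` on tempered distributions. -/
def besselHalf :
    𝓢'(EuclideanSpace ℝ (Fin N), ℂ) →L[ℂ] 𝓢'(EuclideanSpace ℝ (Fin N), ℂ) :=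
  TemperedDistribution.fourierMultiplierCLM ℂ besselSymbol

/-- A real `L_q(ℝ^N)` function as a tempered distribution. -/
def toDistribution {q : ℝ≥0∞} [Fact (1 ≤ q)]
    (u : Lp ℝ q (volume : Measure (EuclideanSpace ℝ (Fin N)))) :
    𝓢'(EuclideanSpace ℝ (Fin N), ℂ) :=
  Lp.toTemperedDistribution (Complex.ofRealCLM.compLp u)

/-- `u` belongs to `L_q(ℝ^N)` and `v = (1 - Δ)^{-1/2} u`, with `v ∈ L_q(ℝ^N)`. -/
def IsBesselHalf {q : ℝ≥0∞} [Fact (1 ≤ q)]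
    (u : EuclideanSpace ℝ (Fin N) →ₘ[volume] ℝ)
    (v : Lp ℝ q (volume : Measure (EuclideanSpace ℝ (Fin N)))) : Prop :=
  ∃ U : Lp ℝ q (volume : Measure (EuclideanSpace ℝ (Fin N))),
    (U : EuclideanSpace ℝ (Fin N) →ₘ[volume] ℝ) = u ∧
      toDistribution v = besselHalf (toDistribution U)

/-- `ι` is a linear extension map `L_{1,loc}(Ω) → L_{1,loc}(ℝ^N)` (its values outside
`L_{1,loc}(Ω)` are irrelevant): for all `1 < q < ∞` it extends functions of `W^1_q(Ω)`, is bounded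
from `W^m_q(Ω)` to `W^m_q(ℝ^N)` for `m = 0, 1` (with `W^0_q = L_q`), and
`‖(1 - Δ)^{-1/2} ι(∇F)‖_{L_q(ℝ^N)} ≤ C ‖F‖_{L_q(Ω)}` for `F ∈ W^1_q(Ω)`. -/
structure IsExtensionMap (Ω : Set (EuclideanSpace ℝ (Fin N)))
    (ι : (EuclideanSpace ℝ (Fin N) →ₘ[volume.restrict Ω] ℝ) →
      (EuclideanSpace ℝ (Fin N) →ₘ[volume] ℝ)) : Prop where
  locallyIntegrable : ∀ F : EuclideanSpace ℝ (Fin N) →ₘ[volume.restrict Ω] ℝ,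
    LocallyIntegrableOn F Ω volume → LocallyIntegrable (ι F) volume
  map_add : ∀ F G : EuclideanSpace ℝ (Fin N) →ₘ[volume.restrict Ω] ℝ,
    LocallyIntegrableOn F Ω volume → LocallyIntegrableOn G Ω volume →
    ι (F + G) = ι F + ι G
  map_smul : ∀ (c : ℝ) (F : EuclideanSpace ℝ (Fin N) →ₘ[volume.restrict Ω] ℝ),
    LocallyIntegrableOn F Ω volume → ι (c • F) = c • ι F
  extends_eq : ∀ q : ℝ≥0∞, 1 < q → q < ∞ →
    ∀ F : EuclideanSpace ℝ (Fin N) →ₘ[volume.restrict Ω] ℝ,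
      sobolevNorm Ω q 1 F < ∞ → ι F =ᵐ[volume.restrict Ω] F
  norm_le : ∀ q : ℝ≥0∞, 1 < q → q < ∞ → ∃ C : ℝ≥0,
    ∀ m ≤ 1, ∀ F : EuclideanSpace ℝ (Fin N) →ₘ[volume.restrict Ω] ℝ,
      sobolevNorm Ω q m F < ∞ → sobolevNorm univ q m (ι F) ≤ C * sobolevNorm Ω q m F
  bessel_grad_le : ∀ (q : ℝ≥0∞) [Fact (1 ≤ q)], 1 < q → q < ∞ → ∃ C : ℝ≥0,
    ∀ (F G : EuclideanSpace ℝ (Fin N) →ₘ[volume.restrict Ω] ℝ) (i : Fin N),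
      sobolevNorm Ω q 1 F < ∞ → HasWeakPartial Ω i F G →
      ∃ v : Lp ℝ q (volume : Measure (EuclideanSpace ℝ (Fin N))),
        IsBesselHalf (ι G) v ∧ ‖v‖ₑ ≤ C * sobolevNorm Ω q 0 F

end Bessel

section Time

/-- `f'` is the weak derivative of the Banach space valued function `f` on `(0, T)`. -/
def HasWeakTimeDeriv {X : Type*} [NormedAddCommGroup X] [NormedSpace ℝ X]
    (T : ℝ) (f f' : ℝ → X) : Prop :=
  LocallyIntegrableOn f (Ioo 0 T) volume ∧ LocallyIntegrableOn f' (Ioo 0 T) volume ∧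
    ∀ φ : ℝ → ℝ, IsTestFunction (Ioo 0 T) φ →
      ∫ t in Ioo 0 T, deriv φ t • f t = - ∫ t in Ioo 0 T, φ t • f' t

/-- `f ∈ L_b((0, T), W^1_q(Ω))`, with spatial gradient `Df`. -/
structure MemBochnerW1 {N : ℕ} (Ω : Set (EuclideanSpace ℝ (Fin N))) {q : ℝ≥0∞} [Fact (1 ≤ q)]
    (T : ℝ) (b : ℝ≥0∞) (f : ℝ → Lp ℝ q (volume.restrict Ω))
    (Df : Fin N → ℝ → Lp ℝ q (volume.restrict Ω)) : Prop where
  memLp : MemLp f b (volume.restrict (Ioo 0 T))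
  memLp_grad : ∀ i, MemLp (Df i) b (volume.restrict (Ioo 0 T))
  grad : ∀ᵐ t ∂volume.restrict (Ioo 0 T), ∀ i, HasWeakPartial Ω i (f t) (Df i t)

end Time

end FreeBoundary

end

noncomputable section

namespace FreeBoundary

/-! ### Product rule for weak derivatives of bilinear expressions -/

section ProductRule

set_option linter.unusedSectionVars false

open Filter Topology ContinuousLinearMap

variable {E : Type*} [NormedAddCommGroup E] [NormedSpace ℝ E] [FiniteDimensional ℝ E]
  [MeasurableSpace E] [BorelSpace E] {μ : Measure E} [μ.IsAddHaarMeasure]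
  {X Y Z : Type*} [NormedAddCommGroup X] [NormedSpace ℝ X] [NormedAddCommGroup Y]
  [NormedSpace ℝ Y] [NormedAddCommGroup Z] [NormedSpace ℝ Z] [CompleteSpace Z]

/-! The time derivative falls either on ∇f or on g, and each case needs its own bounded extension of
the bilinear map (u, v) ↦ (1 - Δ)^{-1/2} ι((∂ᵢu) v), which is first considered for u, v ∈ W^1_q(Ω).

If v is merely in L_q, Hölder puts (∂ᵢu) v in L_{q/2}. There ι is bounded, and (1 - Δ)^{-1/2} maps
L_{q/2} to L_q by Young's inequality, because its kernel lies in L_{q/(q-1)} when q > N. This gives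
a bounded map B on W^1_q × L_q, controlled by ∂ᵢu alone. If u is merely in L_q, write (∂ᵢu) v =
∂ᵢ(uv) - u ∂ᵢv. The last term is of the type just treated. The first is controlled by ‖uv‖_{L_q}
through (e-2) and density, and uv ∈ L_q since W^1_q(Ω) ⊂ L_∞(Ω) by extension and Morrey's
inequality. This gives A on L_q × W^1_q. Both maps are built in `IsExtensionMap.exists_bilin`.

It remains to show ∂_t B(f, g) = A(∂_t f, g) + B(f, ∂_t g), after which the estimate is immediate.
Exponents may be ∞, so approximating f and g in norm by functions smooth in time is not available.
Instead `weak_product_rule` doubles the variable: f is taken at y, g at x, with weight φ(x) ρ_n(x -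
y), and the derivative is moved from g to the mollifier and from there to f. The limit n → ∞ needs
only the continuity of h ↦ ∫ B(F(x + h), G(x)) dx, which holds for conjugate exponents because one
of them is finite. The undifferentiated term has no given pair of conjugate exponents; it gets the
pair (∞, 1), since an L_q(Ω)-valued f with integrable weak derivative is bounded
(`HasWeakTimeDeriv.memLp_top`). -/

theorem continuous_translate_toLp {p : ℝ≥0∞} [Fact (1 ≤ p)] (hp : p ≠ ∞) {F : E → X}
    (hF : MemLp F p μ) :
    Continuous fun h : E =>
      (hF.comp_measurePreserving (measurePreserving_add_right μ h)).toLp _ := by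
  have h1 : Continuous fun h : E => (ContinuousMap.mk fun x : E × E => x.2 + x.1).curry h :=
    ContinuousMap.continuous _
  exact (continuous_const (y := hF.toLp F)).compMeasurePreservingLp h1
    (fun h => measurePreserving_add_right μ h) hp

theorem integral_bilin_eq_lpPairing {p p' : ℝ≥0∞} [Fact (1 ≤ p)] [Fact (1 ≤ p')]
    [p.HolderConjugate p'] (B : X →L[ℝ] Y →L[ℝ] Z) {F : E → X} {G : E → Y}
    (hF : MemLp F p μ) (hG : MemLp G p' μ) :
    ∫ x, B (F x) (G x) ∂μ = B.lpPairing μ p p' (hF.toLp F) (hG.toLp G) := by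
  rw [lpPairing_eq_integral]
  refine integral_congr_ae ?_
  filter_upwards [hF.coeFn_toLp, hG.coeFn_toLp] with x h1 h2
  rw [h1, h2]

/-- One of two conjugate exponents is finite, and translation is continuous in that Lebesgue space.
If `p = ∞`, invariance of the measure moves the translation onto `G`. -/
theorem continuous_integral_bilin_translate {p p' : ℝ≥0∞} (hpp : p.HolderConjugate p')
    (B : X →L[ℝ] Y →L[ℝ] Z) {F : E → X} {G : E → Y}
    (hF : MemLp F p μ) (hG : MemLp G p' μ) :
    Continuous fun h : E => ∫ x, B (F (x + h)) (G x) ∂μ := by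
  have : Fact (1 ≤ p) := ⟨ENNReal.HolderConjugate.one_le p p'⟩
  have : Fact (1 ≤ p') := ⟨have := hpp.symm; ENNReal.HolderConjugate.one_le p' p⟩
  by_cases hp : p = ∞
  · have hp' : p' ≠ ∞ := by
      rintro rfl
      have := hpp.inv_add_inv_eq_inv
      simp [hp] at this
    have key : ∀ h : E, ∫ x, B (F (x + h)) (G x) ∂μ =
        B.lpPairing μ p p' (hF.toLp F)
          ((hG.comp_measurePreserving (measurePreserving_add_right μ (-h))).toLp _) := by
      intro h
      rw [← integral_bilin_eq_lpPairing,
        ← integral_add_right_eq_self (fun x => B (F x) (((fun x => G x) ∘ fun x => x + -h) x)) h]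
      simp
    simp_rw [key]
    exact (B.lpPairing μ p p' (hF.toLp F)).continuous.comp
      ((continuous_translate_toLp hp' hG).comp continuous_neg)
  · have key : ∀ h : E, ∫ x, B (F (x + h)) (G x) ∂μ =
        B.lpPairing μ p p'
          ((hF.comp_measurePreserving (measurePreserving_add_right μ h)).toLp _) (hG.toLp G) := by
      intro h
      rw [← integral_bilin_eq_lpPairing]
      rfl
    simp_rw [key]
    exact ((B.lpPairing μ p p').flip (hG.toLp G)).continuous.comp
      (continuous_translate_toLp hp hF)

theorem integrable_kernel_bilin (B : X →L[ℝ] Y →L[ℝ] Z) {F : E → X} {G : E → Y}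
    (hF : Integrable F μ) (hG : Integrable G μ) {κ : E × E → ℝ} (hκ : Continuous κ) {C : ℝ}
    (hC : ∀ z, |κ z| ≤ C) :
    Integrable (fun z : E × E => κ z • B (F z.2) (G z.1)) (μ.prod μ) := by
  refine Integrable.bdd_smul ?_ C hκ.aestronglyMeasurable (ae_of_all _ fun z => hC z)
  refine hG.op_fst_snd (op := fun y x => B x y) ?_ ⟨‖B‖, fun y x => ?_⟩ hF
  · exact B.continuous₂.comp continuous_swap
  · calc _ ≤ ‖B‖ * ‖x‖ * ‖y‖ := B.le_opNorm₂ x y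
      _ = _ := by ring

/-- By Fubini and the substitution y = x + h, the double integral is the mollification at 0 of the
correlation h ↦ ∫ B(F(x + h), G(x)) dx, which is continuous. Neither factor is approximated in norm.
-/
theorem tendsto_integral_mollifier_bilin {p p' : ℝ≥0∞} (hpp : p.HolderConjugate p')
    (B : X →L[ℝ] Y →L[ℝ] Z) {F : E → X} {G : E → Y}
    (hF : MemLp F p μ) (hG : MemLp G p' μ) (hF1 : Integrable F μ) (hG1 : Integrable G μ)
    {ρ : ℕ → ContDiffBump (0 : E)} (hρ : Tendsto (fun n => (ρ n).rOut) atTop (𝓝 0)) :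
    Tendsto (fun n => ∫ x, ∫ y, (ρ n).normed μ (x - y) • B (F y) (G x) ∂μ ∂μ) atTop
      (𝓝 (∫ x, B (F x) (G x) ∂μ)) := by
  have hc := continuous_integral_bilin_translate hpp B hF hG
  have h1 := ContDiffBump.convolution_tendsto_right_of_continuous (μ := μ) hρ hc 0
  simp only [add_zero] at h1
  refine h1.congr fun n => ?_
  rw [convolution_lsmul_swap]
  simp only [zero_sub, ContDiffBump.normed_neg, ← integral_smul]
  obtain ⟨C, hC⟩ : ∃ C, ∀ x, ‖(ρ n).normed μ x‖ ≤ C :=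
    (ρ n).hasCompactSupport_normed.exists_bound_of_continuous (ρ n).continuous_normed
  have hint := integrable_kernel_bilin B hF1 hG1
    (κ := fun z => (ρ n).normed μ (z.1 - z.2))
    ((ρ n).continuous_normed.comp (continuous_fst.sub continuous_snd)) (C := C)
    (fun z => hC _)
  have hmp := measurePreserving_prod_add μ μ
  have hint2 := hmp.integrable_comp_of_integrable hint
  rw [integral_integral_swap]
  · refine integral_congr_ae (ae_of_all _ fun x => ?_)
    have := integral_add_left_eq_self (μ := μ)
      (fun y => (ρ n).normed μ (x - y) • B (F y) (G x)) x
    simpa [ContDiffBump.normed_neg] using this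
  · refine (Integrable.swap hint2).congr (ae_of_all _ fun z => ?_)
    simp [Function.uncurry, ContDiffBump.normed_neg]

theorem integral_bilin_kernel_right [CompleteSpace Y] (B : X →L[ℝ] Y →L[ℝ] Z) {F : E → X}
    {G : E → Y} (hF : Integrable F μ) (hG : Integrable G μ) {κ : E × E → ℝ} (hκ : Continuous κ)
    {C : ℝ} (hC : ∀ z, |κ z| ≤ C) :
    Integrable (fun y => B (F y) (∫ x, κ (x, y) • G x ∂μ)) μ ∧
    ∫ x, ∫ y, κ (x, y) • B (F y) (G x) ∂μ ∂μ = ∫ y, B (F y) (∫ x, κ (x, y) • G x ∂μ) ∂μ := by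
  have hint := integrable_kernel_bilin B hF hG hκ hC
  have hy : ∀ y, ∫ x, κ (x, y) • B (F y) (G x) ∂μ = B (F y) (∫ x, κ (x, y) • G x ∂μ) := by
    intro y
    have hGy : Integrable (fun x => κ (x, y) • G x) μ :=
      Integrable.bdd_smul hG C (hκ.comp (by fun_prop)).aestronglyMeasurable
        (ae_of_all _ fun x => hC _)
    rw [← (B (F y)).integral_comp_comm hGy]
    simp
  refine ⟨?_, ?_⟩
  · refine (hint.integral_prod_right).congr (ae_of_all _ fun y => ?_)
    exact hy y
  · rw [integral_integral_swap hint]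
    exact integral_congr_ae (ae_of_all _ hy)

/-- For fixed x the y-integral passes through the bounded map `B · (G x)`; the outer integral is
untouched, so nothing is asked of `G`. -/
theorem integral_bilin_kernel_left [CompleteSpace X] (B : X →L[ℝ] Y →L[ℝ] Z) {F : E → X}
    {G : E → Y} (hF : Integrable F μ) {κ : E × E → ℝ} (hκ : Continuous κ)
    {C : ℝ} (hC : ∀ z, |κ z| ≤ C) :
    ∫ x, ∫ y, κ (x, y) • B (F y) (G x) ∂μ ∂μ = ∫ x, B (∫ y, κ (x, y) • F y ∂μ) (G x) ∂μ := by
  refine integral_congr_ae (ae_of_all _ fun x => ?_)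
  have hFx : Integrable (fun y => κ (x, y) • F y) μ :=
    Integrable.bdd_smul hF C (hκ.comp (by fun_prop)).aestronglyMeasurable
      (ae_of_all _ fun x => hC _)
  have := (B.flip (G x)).integral_comp_comm hFx
  simpa using this

theorem setIntegral_smul_eq_integral_indicator {S K : Set E} (hKS : K ⊆ S) {ψ : E → ℝ}
    (hψ : ∀ x ∉ K, ψ x = 0) (u : E → X) :
    ∫ x in S, ψ x • u x ∂μ = ∫ x, ψ x • K.indicator u x ∂μ := by
  rw [setIntegral_eq_integral_of_forall_compl_eq_zero
    (fun x hx => by rw [hψ x fun h => hx (hKS h), zero_smul])]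
  refine integral_congr_ae (ae_of_all _ fun x => ?_)
  by_cases hx : x ∈ K
  · simp [hx]
  · simp [hψ x hx]

theorem IsTestFunction.exists_bound_fderiv {D : Set E} {φ : E → ℝ} (hφ : IsTestFunction D φ)
    (e : E) : ∃ C, ∀ x, |fderiv ℝ φ x e| ≤ C := by
  have hc : HasCompactSupport fun x => fderiv ℝ φ x e := hφ.2.1.fderiv_apply ℝ e
  obtain ⟨C, hC⟩ := hc.exists_bound_of_continuous
    ((hφ.1.continuous_fderiv (by simp)).clm_apply continuous_const)
  exact ⟨C, hC⟩

theorem integrable_indicator_of_memLp {S : Set E} {u : E → X} {p p' : ℝ≥0∞}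
    (hpp : p.HolderConjugate p') (hS : IsCompact S) (h : MemLp u p (μ.restrict S)) :
    Integrable (S.indicator u) μ := by
  have : IsFiniteMeasure (μ.restrict S) := ⟨by simpa using hS.measure_lt_top⟩
  rw [← memLp_one_iff_integrable]
  exact (memLp_indicator_iff_restrict hS.measurableSet).2
    (h.mono_exponent (ENNReal.HolderConjugate.one_le p p'))

theorem MemLp.continuous_smul_indicator {S : Set E} {u : E → X} {p : ℝ≥0∞} {ψ : E → ℝ}
    (hS : IsCompact S) (h : MemLp u p (μ.restrict S)) (hψ : Continuous ψ) {C : ℝ}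
    (hC : ∀ x, |ψ x| ≤ C) : MemLp (fun x => ψ x • S.indicator u x) p μ :=
  MemLp.smul ((memLp_indicator_iff_restrict hS.measurableSet).2 h)
    (memLp_top_of_bound hψ.aestronglyMeasurable C (ae_of_all _ hC))

/-- The product rule for weak derivatives in the direction `e`, for a bilinear map given by two
bounded bilinear maps `A` and `B` that are compatible along `j` and `k`. -/
theorem weak_product_rule {V W H K : Type*} [NormedAddCommGroup V] [NormedSpace ℝ V]
    [NormedAddCommGroup W] [NormedSpace ℝ W] [NormedAddCommGroup H] [NormedSpace ℝ H]
    [CompleteSpace H] [NormedAddCommGroup K] [NormedSpace ℝ K] [CompleteSpace K]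
    (j : V →L[ℝ] H) (k : W →L[ℝ] K) (B : V →L[ℝ] K →L[ℝ] Z) (A : H →L[ℝ] W →L[ℝ] Z)
    (hAB : ∀ v w, B v (k w) = A (j v) w) {D : Set E} (hD : IsOpen D) (e : E)
    {f : E → V} {f' : E → H} {g : E → W} {g' : E → K} {a a' b b' c c' : ℝ≥0∞}
    (haa : a.HolderConjugate a') (hbb : b.HolderConjugate b') (hcc : c.HolderConjugate c')
    (hf : ∀ S ⊆ D, IsCompact S → MemLp f b (μ.restrict S))
    (hg' : ∀ S ⊆ D, IsCompact S → MemLp g' b' (μ.restrict S))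
    (hf' : ∀ S ⊆ D, IsCompact S → MemLp f' a (μ.restrict S))
    (hg : ∀ S ⊆ D, IsCompact S → MemLp g a' (μ.restrict S))
    (hfc : ∀ S ⊆ D, IsCompact S → MemLp (fun x => j (f x)) c (μ.restrict S))
    (hgc : ∀ S ⊆ D, IsCompact S → MemLp g c' (μ.restrict S))
    (hwf : ∀ φ : E → ℝ, IsTestFunction D φ →
      ∫ x in D, fderiv ℝ φ x e • j (f x) ∂μ = - ∫ x in D, φ x • f' x ∂μ)
    (hwg : ∀ φ : E → ℝ, IsTestFunction D φ →
      ∫ x in D, fderiv ℝ φ x e • k (g x) ∂μ = - ∫ x in D, φ x • g' x ∂μ)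
    {φ : E → ℝ} (hφ : IsTestFunction D φ) :
    ∫ x in D, fderiv ℝ φ x e • B (f x) (k (g x)) ∂μ =
      - ∫ x in D, φ x • (A (f' x) (g x) + B (f x) (g' x)) ∂μ := by
  -- All functions are truncated to a compact neighbourhood `S` of the support of φ inside `D`.
  -- Truncations are integrable on all of `E`, and y stays in `S` when φ x ≠ 0 and |x - y| ≤ δ.
  obtain ⟨δ, hδ, hδD⟩ := hφ.2.1.isCompact.exists_cthickening_subset_open hD hφ.2.2
  set S := Metric.cthickening δ (tsupport φ) with hS
  have hSc : IsCompact S := hφ.2.1.isCompact.cthickening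
  have hSm : MeasurableSet S := hSc.measurableSet
  have hφS : tsupport φ ⊆ S := Metric.self_subset_cthickening _
  have hφ0 : ∀ x ∉ S, φ x = 0 := fun x hx => image_eq_zero_of_notMem_tsupport fun h => hx (hφS h)
  have hφ'0 : ∀ x ∉ S, fderiv ℝ φ x e = 0 := fun x hx => by
    have : fderiv ℝ φ x = 0 := by
      by_contra hne
      exact hx (hφS (support_fderiv_subset ℝ hne))
    simp [this]
  obtain ⟨C₀, hC₀⟩ := hφ.2.1.exists_bound_of_continuous hφ.1.continuous
  obtain ⟨C₁, hC₁⟩ := hφ.exists_bound_fderiv e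
  set ρ : ℕ → ContDiffBump (0 : E) := fun n =>
    ⟨δ / (n + 2) / 2, δ / (n + 2), by positivity, half_lt_self (by positivity)⟩ with hρdef
  have hρ : Tendsto (fun n => (ρ n).rOut) atTop (𝓝 0) :=
    tendsto_const_nhds.div_atTop
      (tendsto_atTop_add_const_right _ _ tendsto_natCast_atTop_atTop)
  have hρδ : ∀ n, (ρ n).rOut ≤ δ := fun n => by
    apply div_le_self hδ.le
    have : (0 : ℝ) ≤ n := n.cast_nonneg
    linarith
  have hF := integrable_indicator_of_memLp hbb hSc (hf S hδD hSc)
  have hF' := integrable_indicator_of_memLp haa hSc (hf' S hδD hSc)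
  have hG := integrable_indicator_of_memLp haa.symm hSc (hg S hδD hSc)
  have hG' := integrable_indicator_of_memLp hbb.symm hSc (hg' S hδD hSc)
  have hjF := integrable_indicator_of_memLp hcc hSc (hfc S hδD hSc)
  have hkG : Integrable (S.indicator fun x => k (g x)) μ := by
    refine (k.integrable_comp hG).congr (ae_of_all _ fun x => ?_)
    by_cases hx : x ∈ S <;> simp [hx]
  have hφ'c : Continuous fun x => fderiv ℝ φ x e :=
    (hφ.1.continuous_fderiv (by simp)).clm_apply continuous_const
  -- Three limits, one for each pair of exponents: (c, c') for the undifferentiated product, (b, b')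
  -- for B(f, g'), (a, a') for A(f', g).
  have t1 := tendsto_integral_mollifier_bilin hcc A (F := S.indicator fun x => j (f x))
    (G := fun x => fderiv ℝ φ x e • S.indicator g x)
    ((memLp_indicator_iff_restrict hSm).2 (hfc S hδD hSc))
    (MemLp.continuous_smul_indicator hSc (hgc S hδD hSc) hφ'c hC₁) hjF
    (hG.bdd_smul C₁ hφ'c.aestronglyMeasurable (ae_of_all _ hC₁)) hρ
  have m2 := MemLp.continuous_smul_indicator hSc (hg' S hδD hSc) hφ.1.continuous hC₀
  have t2 := tendsto_integral_mollifier_bilin hbb B (F := S.indicator f)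
    (G := fun x => φ x • S.indicator g' x)
    ((memLp_indicator_iff_restrict hSm).2 (hf S hδD hSc)) m2 hF
    (hG'.bdd_smul C₀ hφ.1.continuous.aestronglyMeasurable (ae_of_all _ hC₀)) hρ
  have m3 := MemLp.continuous_smul_indicator hSc (hg S hδD hSc) hφ.1.continuous hC₀
  have t3 := tendsto_integral_mollifier_bilin haa A (F := S.indicator f')
    (G := fun x => φ x • S.indicator g x)
    ((memLp_indicator_iff_restrict hSm).2 (hf' S hδD hSc)) m3 hF'
    (hG.bdd_smul C₀ hφ.1.continuous.aestronglyMeasurable (ae_of_all _ hC₀)) hρ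
  -- The product rule before the limit, with f at y and g at x. Integration by parts in x puts the
  -- derivative on g and on the mollifier; as the latter depends on x - y only, its derivative is
  -- also a y-derivative, which f absorbs.
  have key : ∀ n, ∫ x, ∫ y, (ρ n).normed μ (x - y) •
      A (S.indicator (fun x => j (f x)) y) (fderiv ℝ φ x e • S.indicator g x) ∂μ ∂μ =
      - (∫ x, ∫ y, (ρ n).normed μ (x - y) • B (S.indicator f y) (φ x • S.indicator g' x) ∂μ ∂μ) -
      ∫ x, ∫ y, (ρ n).normed μ (x - y) • A (S.indicator f' y) (φ x • S.indicator g x) ∂μ ∂μ := by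
    intro n
    set r : E → ℝ := (ρ n).normed μ with hr
    have hrs : ContDiff ℝ ((⊤ : ℕ∞) : WithTop ℕ∞) r := (ρ n).contDiff_normed
    have hrd : Differentiable ℝ r := hrs.differentiable (by simp)
    have hφd : Differentiable ℝ φ := hφ.1.differentiable (by simp)
    have hrT : IsTestFunction univ r := ⟨hrs, (ρ n).hasCompactSupport_normed, subset_univ _⟩
    obtain ⟨R₀, hR₀⟩ := hrT.2.1.exists_bound_of_continuous hrs.continuous
    obtain ⟨R₁, hR₁⟩ := hrT.exists_bound_fderiv e
    have hr'c : Continuous fun x => fderiv ℝ r x e :=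
      (hrs.continuous_fderiv (by simp)).clm_apply continuous_const
    have hκ₁ : Continuous fun z : E × E => fderiv ℝ φ z.1 e * r (z.1 - z.2) :=
      (hφ'c.comp continuous_fst).mul (hrs.continuous.comp (continuous_fst.sub continuous_snd))
    have hκ₂ : Continuous fun z : E × E => φ z.1 * r (z.1 - z.2) :=
      (hφ.1.continuous.comp continuous_fst).mul
        (hrs.continuous.comp (continuous_fst.sub continuous_snd))
    have hκ₃ : Continuous fun z : E × E => φ z.1 * fderiv ℝ r (z.1 - z.2) e :=
      (hφ.1.continuous.comp continuous_fst).mul (hr'c.comp (continuous_fst.sub continuous_snd))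
    have bmul : ∀ {s t c d : ℝ}, |s| ≤ c → |t| ≤ d → |s * t| ≤ c * d := fun h1 h2 => by
      rw [abs_mul]
      exact mul_le_mul h1 h2 (abs_nonneg _) ((abs_nonneg _).trans h1)
    have bκ₁ : ∀ z : E × E, |fderiv ℝ φ z.1 e * r (z.1 - z.2)| ≤ C₁ * R₀ := fun z =>
      bmul (hC₁ _) (hR₀ _)
    have bκ₂ : ∀ z : E × E, |φ z.1 * r (z.1 - z.2)| ≤ C₀ * R₀ := fun z => bmul (hC₀ _) (hR₀ _)
    have bκ₃ : ∀ z : E × E, |φ z.1 * fderiv ℝ r (z.1 - z.2) e| ≤ C₀ * R₁ := fun z =>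
      bmul (hC₀ _) (hR₁ _)
    -- the weak derivative of `g`, tested with `φ` times the mollifier
    have step1 : ∀ y, ∫ x, (fderiv ℝ φ x e * r (x - y)) • S.indicator (fun x => k (g x)) x ∂μ =
        - (∫ x, (φ x * r (x - y)) • S.indicator g' x ∂μ) -
        ∫ x, (φ x * fderiv ℝ r (x - y) e) • S.indicator (fun x => k (g x)) x ∂μ := by
      intro y
      have hT : IsTestFunction D fun x => φ x * r (x - y) :=
        ⟨hφ.1.mul (hrs.comp (contDiff_id.sub contDiff_const)), hφ.2.1.mul_right,
          (closure_mono (Function.support_mul_subset_left _ _)).trans hφ.2.2⟩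
      have hder : ∀ x, fderiv ℝ (fun x => φ x * r (x - y)) x e =
          fderiv ℝ φ x e * r (x - y) + φ x * fderiv ℝ r (x - y) e := by
        intro x
        have h1 : DifferentiableAt ℝ (fun x => r (x - y)) x :=
          (hrd (x - y)).comp x (differentiableAt_id.sub_const y)
        rw [fderiv_fun_mul (hφd x) h1, fderiv_comp_sub]
        simp
        ring
      have h := hwg _ hT
      simp only [hder] at h
      rw [setIntegral_smul_eq_integral_indicator hδD (fun x hx => by simp [hφ0 x hx, hφ'0 x hx]),
        setIntegral_smul_eq_integral_indicator hδD (fun x hx => by simp [hφ0 x hx])] at h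
      rw [← h, ← integral_sub]
      · simp [add_smul]
      · exact hkG.bdd_smul (C₁ * R₀ + C₀ * R₁)
          (((hκ₁.comp (.prodMk_left y)).add (hκ₃.comp (.prodMk_left y))).aestronglyMeasurable)
          (ae_of_all _ fun x => (abs_add_le _ _).trans (add_le_add (bκ₁ (x, y)) (bκ₃ (x, y))))
      · exact hkG.bdd_smul (C₀ * R₁) (hκ₃.comp (.prodMk_left y)).aestronglyMeasurable
          (ae_of_all _ fun x => bκ₃ (x, y))
    -- the weak derivative of `f`, tested with the mollifier
    have step2 : ∀ x, φ x ≠ 0 →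
        ∫ y, (fderiv ℝ r (x - y) e) • S.indicator (fun x => j (f x)) y ∂μ =
          ∫ y, r (x - y) • S.indicator f' y ∂μ := by
      intro x hx
      have hsupp : tsupport (fun y => r (x - y)) ⊆ S := by
        refine closure_minimal (fun y hy => ?_) Metric.isClosed_cthickening
        have hy' : x - y ∈ Function.support r := hy
        rw [hr, ContDiffBump.support_normed_eq, mem_ball_zero_iff] at hy'
        refine Metric.mem_cthickening_of_dist_le y x δ _ (subset_tsupport _ hx) ?_
        rw [dist_comm, dist_eq_norm]
        exact hy'.le.trans (hρδ n)
      have hT : IsTestFunction D fun y => r (x - y) :=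
        ⟨hrs.comp (contDiff_const.sub contDiff_id),
          hSc.of_isClosed_subset (isClosed_tsupport _) hsupp, hsupp.trans hδD⟩
      have hder : ∀ y, fderiv ℝ (fun y => r (x - y)) y e = - fderiv ℝ r (x - y) e := by
        intro y
        have h1 := ((hrd (x - y)).hasFDerivAt.comp y ((hasFDerivAt_id y).const_sub x)).fderiv
        simp only [Function.comp_def] at h1
        rw [h1]
        simp
      have hr0 : ∀ y ∉ S, r (x - y) = 0 := fun y hy =>
        image_eq_zero_of_notMem_tsupport (f := fun y => r (x - y)) fun h => hy (hsupp h)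
      have hr'0 : ∀ y ∉ S, - fderiv ℝ r (x - y) e = 0 := fun y hy => by
        rw [← hder]
        have : fderiv ℝ (fun y => r (x - y)) y = 0 := by
          by_contra hne
          exact hy (hsupp (support_fderiv_subset ℝ hne))
        simp [this]
      have h := hwf _ hT
      simp only [hder] at h
      rw [setIntegral_smul_eq_integral_indicator hδD hr'0,
        setIntegral_smul_eq_integral_indicator hδD hr0] at h
      simpa [integral_neg] using h
    -- The compatibility `hAB` turns A(j f, g) into B(f, k g), to which the weak derivative of k ∘ g
    -- applies; `e4` turns it back so that the weak derivative of j ∘ f applies.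
    have e1 : ∫ x, ∫ y, r (x - y) •
        A (S.indicator (fun x => j (f x)) y) (fderiv ℝ φ x e • S.indicator g x) ∂μ ∂μ =
        ∫ x, ∫ y, (fderiv ℝ φ x e * r (x - y)) •
          B (S.indicator f y) (S.indicator (fun x => k (g x)) x) ∂μ ∂μ := by
      congr 1 with x
      congr 1 with y
      by_cases hx : x ∈ S <;> by_cases hy : y ∈ S <;> simp [hx, hy, hAB, smul_smul, mul_comm]
    have e2 : ∫ x, ∫ y, r (x - y) • B (S.indicator f y) (φ x • S.indicator g' x) ∂μ ∂μ =
        ∫ x, ∫ y, (φ x * r (x - y)) • B (S.indicator f y) (S.indicator g' x) ∂μ ∂μ := by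
      simp [smul_smul, mul_comm]
    have e3 : ∫ x, ∫ y, r (x - y) • A (S.indicator f' y) (φ x • S.indicator g x) ∂μ ∂μ =
        ∫ x, ∫ y, (φ x * r (x - y)) • A (S.indicator f' y) (S.indicator g x) ∂μ ∂μ := by
      simp [smul_smul, mul_comm]
    have e4 : ∫ x, ∫ y, (φ x * fderiv ℝ r (x - y) e) •
          B (S.indicator f y) (S.indicator (fun x => k (g x)) x) ∂μ ∂μ =
        ∫ x, ∫ y, (φ x * fderiv ℝ r (x - y) e) •
          A (S.indicator (fun x => j (f x)) y) (S.indicator g x) ∂μ ∂μ := by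
      congr 1 with x
      congr 1 with y
      by_cases hx : x ∈ S <;> by_cases hy : y ∈ S <;> simp [hx, hy, hAB]
    obtain ⟨-, r1⟩ := integral_bilin_kernel_right B hF hkG hκ₁ bκ₁
    obtain ⟨i2, r2⟩ := integral_bilin_kernel_right B hF hG' hκ₂ bκ₂
    obtain ⟨i3, r3⟩ := integral_bilin_kernel_right B hF hkG hκ₃ bκ₃
    have r4 := integral_bilin_kernel_left A (G := S.indicator g) hjF hκ₃ bκ₃
    have r5 := integral_bilin_kernel_left A (G := S.indicator g) hF' hκ₂ bκ₂
    simp only at r1 r2 r3 r4 r5 i2 i3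
    rw [e1, e2, e3, r1, r5, r2]
    simp only [step1, map_sub, map_neg]
    rw [integral_sub (by exact i2.neg) i3, integral_neg, ← r3, e4, r4]
    congr 1
    congr 1 with x
    -- Where φ vanishes both sides are 0; `step2` is not available there, since the mollifier around
    -- x may reach outside `S`.
    by_cases hx : φ x = 0
    · simp [hx]
    · simp only [mul_smul, integral_smul, step2 x hx]
  have lim := tendsto_nhds_unique t1 ((t2.neg.sub t3).congr fun n => (key n).symm)
  rw [setIntegral_smul_eq_integral_indicator hδD hφ'0,
    setIntegral_smul_eq_integral_indicator hδD hφ0]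
  have l1 : ∫ x, fderiv ℝ φ x e • S.indicator (fun x => B (f x) (k (g x))) x ∂μ =
      ∫ x, A (S.indicator (fun x => j (f x)) x) (fderiv ℝ φ x e • S.indicator g x) ∂μ := by
    congr 1 with x
    by_cases hx : x ∈ S <;> simp [hx, hAB]
  have l2 : ∫ x, φ x • S.indicator (fun x => A (f' x) (g x) + B (f x) (g' x)) x ∂μ =
      ∫ x, (B (S.indicator f x) (φ x • S.indicator g' x) +
        A (S.indicator f' x) (φ x • S.indicator g x)) ∂μ := by
    congr 1 with x
    by_cases hx : x ∈ S <;> simp [hx, add_comm]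
  rw [l1, l2, lim, integral_add, neg_add']
  · rw [← memLp_one_iff_integrable]
    exact B.memLp_of_bilin 1 ((memLp_indicator_iff_restrict hSm).2 (hf S hδD hSc)) m2
  · rw [← memLp_one_iff_integrable]
    exact A.memLp_of_bilin 1 ((memLp_indicator_iff_restrict hSm).2 (hf' S hδD hSc)) m3

end ProductRule

/-! ### Boundedness in time from an integrable weak derivative -/

section TimeRegularity

open Filter Topology

variable {X : Type*} [NormedAddCommGroup X] [NormedSpace ℝ X]

theorem IsTestFunction.exists_Icc {T : ℝ} {ψ : ℝ → ℝ} (hT : 0 < T)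
    (h : IsTestFunction (Ioo 0 T) ψ) :
    ∃ m M, 0 < m ∧ M < T ∧ m ≤ M ∧ ∀ t ∉ Icc m M, ψ t = 0 := by
  rcases (tsupport ψ).eq_empty_or_nonempty with h0 | hne
  -- Here ψ vanishes identically, and the midpoint is an arbitrary choice.
  · refine ⟨T / 2, T / 2, by linarith, by linarith, le_rfl, fun t _ => ?_⟩
    exact image_eq_zero_of_notMem_tsupport (by simp [h0])
  · have hc : IsCompact (tsupport ψ) := h.2.1
    have h1 := h.2.2 (hc.sInf_mem hne)
    have h2 := h.2.2 (hc.sSup_mem hne)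
    refine ⟨sInf (tsupport ψ), sSup (tsupport ψ), h1.1, h2.2, ?_, fun t ht => ?_⟩
    · exact csInf_le hc.bddBelow (hc.sSup_mem hne)
    · refine image_eq_zero_of_notMem_tsupport fun hmem => ht ⟨?_, ?_⟩
      · exact csInf_le hc.bddBelow hmem
      · exact le_csSup hc.bddAbove hmem

/-- Zero total integral makes the primitive vanish again to the right of the support of ψ. -/
theorem IsTestFunction.primitive {T : ℝ} (hT : 0 < T) {ψ : ℝ → ℝ}
    (h : IsTestFunction (Ioo 0 T) ψ) (h0 : ∫ t, ψ t = 0) :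
    IsTestFunction (Ioo 0 T) (fun t => ∫ s in (0 : ℝ)..t, ψ s) ∧
      ∀ t, deriv (fun t => ∫ s in (0 : ℝ)..t, ψ s) t = ψ t := by
  obtain ⟨m, M, hm, hM, hmM, hψ⟩ := h.exists_Icc hT
  have hd : ∀ t, HasDerivAt (fun t => ∫ s in (0 : ℝ)..t, ψ s) (ψ t) t := fun t =>
    h.1.continuous.integral_hasStrictDerivAt 0 t |>.hasDerivAt
  have hder : deriv (fun t => ∫ s in (0 : ℝ)..t, ψ s) = ψ := funext fun t => (hd t).deriv
  have hz : ∀ t ∉ Icc m M, ∫ s in (0 : ℝ)..t, ψ s = 0 := by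
    intro t ht
    rcases lt_or_ge t m with h1 | h1
    · rw [intervalIntegral.integral_zero_ae]
      refine ae_of_all _ fun s hs => hψ s fun hs' => ?_
      have : s ≤ max 0 t := hs.2
      rcases le_max_iff.1 this with h2 | h2 <;> linarith [hs'.1]
    · have h2 : M < t := not_le.1 fun h2 => ht ⟨h1, h2⟩
      rw [intervalIntegral.integral_of_le (by linarith),
        setIntegral_eq_integral_of_forall_compl_eq_zero, h0]
      intro s hs
      refine hψ s fun hs' => hs ⟨by linarith [hs'.1], by linarith [hs'.2]⟩
  have hsub : tsupport (fun t => ∫ s in (0 : ℝ)..t, ψ s) ⊆ Icc m M :=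
    closure_minimal (fun t ht => by_contra fun h' => ht (hz t h')) isClosed_Icc
  refine ⟨⟨?_, isCompact_Icc.of_isClosed_subset (isClosed_tsupport _) hsub, hsub.trans ?_⟩,
    fun t => (hd t).deriv⟩
  · rw [contDiff_infty_iff_deriv, hder]
    exact ⟨fun t => (hd t).differentiableAt, h.1⟩
  · exact fun t ht => ⟨hm.trans_le ht.1, ht.2.trans_lt hM⟩

/-- The primitive of ψ - η is a test function with values in [-1, 1], being a difference of two
distribution functions; the weak derivative is tested with it. -/
theorem norm_integral_sub_le_of_hasWeakTimeDeriv {T : ℝ} (hT : 0 < T) {f f' : ℝ → X}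
    (h : HasWeakTimeDeriv T f f') (hf : IntegrableOn f (Ioo 0 T))
    (hf' : IntegrableOn f' (Ioo 0 T)) {ψ η : ℝ → ℝ}
    (hψ : IsTestFunction (Ioo 0 T) ψ) (hη : IsTestFunction (Ioo 0 T) η)
    (hψ0 : ∀ t, 0 ≤ ψ t) (hη0 : ∀ t, 0 ≤ η t) (hψ1 : ∫ t, ψ t = 1) (hη1 : ∫ t, η t = 1) :
    ‖(∫ t in Ioo 0 T, ψ t • f t) - ∫ t in Ioo 0 T, η t • f t‖ ≤ ∫ t in Ioo 0 T, ‖f' t‖ := by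
  have hψi : Integrable ψ := hψ.1.continuous.integrable_of_hasCompactSupport hψ.2.1
  have hηi : Integrable η := hη.1.continuous.integrable_of_hasCompactSupport hη.2.1
  have hdT : IsTestFunction (Ioo 0 T) (fun t => ψ t - η t) :=
    ⟨hψ.1.sub hη.1, hψ.2.1.sub hη.2.1,
      (tsupport_sub ψ η).trans (union_subset hψ.2.2 hη.2.2)⟩
  obtain ⟨hP, hPd⟩ := hdT.primitive hT (by rw [integral_sub hψi hηi, hψ1, hη1, sub_self])
  have hsmul : ∀ {χ : ℝ → ℝ}, IsTestFunction (Ioo 0 T) χ →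
      Integrable (fun t => χ t • f t) (volume.restrict (Ioo 0 T)) := fun {χ} hχ => by
    obtain ⟨C, hC⟩ := hχ.2.1.exists_bound_of_continuous hχ.1.continuous
    exact hf.bdd_smul C hχ.1.continuous.aestronglyMeasurable (ae_of_all _ hC)
  have hw := h.2.2 _ hP
  simp only [hPd, sub_smul] at hw
  rw [integral_sub (hsmul hψ) (hsmul hη)] at hw
  rw [hw, norm_neg]
  refine (norm_integral_le_integral_norm _).trans (integral_mono_of_nonneg
    (ae_of_all _ fun t => norm_nonneg _) hf'.norm ?_)
  filter_upwards [ae_restrict_mem measurableSet_Ioo] with t ht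
  have hb : ∀ {χ : ℝ → ℝ}, Integrable χ → (∀ t, 0 ≤ χ t) → ∫ t, χ t = 1 →
      0 ≤ ∫ s in (0 : ℝ)..t, χ s ∧ ∫ s in (0 : ℝ)..t, χ s ≤ 1 := fun {χ} hi hp h1 => by
    rw [intervalIntegral.integral_of_le ht.1.le]
    exact ⟨setIntegral_nonneg measurableSet_Ioc fun s _ => hp s,
      h1 ▸ setIntegral_le_integral hi (ae_of_all _ hp)⟩
  have b1 := hb hψi hψ0 hψ1
  have b2 := hb hηi hη0 hη1
  rw [norm_smul, intervalIntegral.integral_sub hψi.intervalIntegrable hηi.intervalIntegrable,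
    Real.norm_eq_abs]
  refine mul_le_of_le_one_left (norm_nonneg _) (abs_le.2 ⟨?_, ?_⟩) <;> linarith

/-- Functions of one variable with an integrable weak derivative are bounded. -/
theorem HasWeakTimeDeriv.memLp_top [CompleteSpace X] {T : ℝ} (hT : 0 < T) {f f' : ℝ → X}
    (h : HasWeakTimeDeriv T f f') (hf : IntegrableOn f (Ioo 0 T))
    (hf' : IntegrableOn f' (Ioo 0 T)) : MemLp f ∞ (volume.restrict (Ioo 0 T)) := by
  set ρ : ℕ → ContDiffBump (0 : ℝ) := fun n =>
    ⟨1 / (n + 1) / 2, 1 / (n + 1), by positivity, half_lt_self (by positivity)⟩ with hρdef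
  have hρ : Tendsto (fun n => (ρ n).rOut) atTop (𝓝 0) := tendsto_one_div_add_atTop_nhds_zero_nat
  -- A fixed reference average around the midpoint; every mollified value of f at an interior point,
  -- for small radius, differs from it by at most ∫ ‖f'‖.
  let b : ContDiffBump (T / 2 : ℝ) := ⟨T / 8, T / 4, by positivity, by linarith⟩
  have hη : IsTestFunction (Ioo 0 T) (b.normed volume) := by
    refine ⟨b.contDiff_normed, b.hasCompactSupport_normed, ?_⟩
    rw [b.tsupport_normed_eq, Real.closedBall_eq_Icc]
    intro t ht
    simp only [b] at ht
    constructor <;> linarith [ht.1, ht.2]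
  -- Lebesgue differentiation carries the bound from mollified values to f almost everywhere; K = 2
  -- is the fixed ratio of outer to inner radius.
  have hconv := ContDiffBump.ae_convolution_tendsto_right_of_locallyIntegrable (μ := volume)
    (φ := ρ) hρ (K := 2) (Eventually.of_forall fun n => by simp only [hρdef]; linarith)
    ((integrable_indicator_iff measurableSet_Ioo).2 hf).locallyIntegrable
  refine memLp_top_of_bound hf.aestronglyMeasurable
    ((∫ t in Ioo 0 T, ‖f' t‖) + ‖∫ t in Ioo 0 T, b.normed volume t • f t‖) ?_
  filter_upwards [ae_restrict_of_ae hconv, ae_restrict_mem measurableSet_Ioo] with x hx hxT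
  rw [indicator_of_mem hxT] at hx
  refine le_of_tendsto hx.norm ?_
  obtain ⟨ε, hε, hball⟩ := Metric.isOpen_iff.1 isOpen_Ioo x hxT
  filter_upwards [hρ.eventually_lt_const hε] with n hn
  have hsupp : tsupport (fun y => (ρ n).normed volume (x - y)) ⊆ Metric.closedBall x (ρ n).rOut := by
    refine closure_minimal (fun y hy => ?_) Metric.isClosed_closedBall
    have hy' : x - y ∈ Function.support ((ρ n).normed volume) := hy
    rw [ContDiffBump.support_normed_eq, mem_ball_zero_iff] at hy'
    rw [Metric.mem_closedBall, dist_comm, dist_eq_norm]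
    exact hy'.le
  have hψ : IsTestFunction (Ioo 0 T) (fun y => (ρ n).normed volume (x - y)) :=
    ⟨(ρ n).contDiff_normed.comp (contDiff_const.sub contDiff_id),
      (isCompact_closedBall _ _).of_isClosed_subset (isClosed_tsupport _) hsupp,
      hsupp.trans ((Metric.closedBall_subset_ball hn).trans hball)⟩
  have key := norm_integral_sub_le_of_hasWeakTimeDeriv hT h hf hf' hψ hη
    (fun t => (ρ n).nonneg_normed _) (fun t => b.nonneg_normed _)
    (by rw [integral_sub_left_eq_self (fun y => (ρ n).normed volume y)]; exact (ρ n).integral_normed)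
    b.integral_normed
  rw [convolution_lsmul_swap]
  have e : ∫ t, (ρ n).normed volume (x - t) • (Ioo 0 T).indicator f t =
      ∫ t in Ioo 0 T, (ρ n).normed volume (x - t) • f t := by
    rw [← integral_indicator measurableSet_Ioo]
    congr 1 with t
    by_cases ht : t ∈ Ioo 0 T <;> simp [ht]
  rw [e]
  have := norm_le_norm_add_norm_sub (∫ t in Ioo 0 T, b.normed volume t • f t)
    (∫ t in Ioo 0 T, (ρ n).normed volume (x - t) • f t)
  rw [norm_sub_rev] at this
  linarith

end TimeRegularity

/-! ### Heat kernel, subordination and integrability of the Bessel kernel -/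

section BesselKernel

open Real Filter

variable {N : ℕ}

/-- The heat kernel `(4πt)^{-N/2} e^{-|x|²/(4t)}`. -/
def heatKernel (t : ℝ) (x : EuclideanSpace ℝ (Fin N)) : ℝ :=
  (4 * π * t) ^ (-((N : ℝ) / 2)) * exp (-(4 * t)⁻¹ * ‖x‖ ^ 2)

theorem heatKernel_pos {t : ℝ} (ht : 0 < t) (x : EuclideanSpace ℝ (Fin N)) :
    0 < heatKernel t x := by
  unfold heatKernel; positivity

theorem measurable_heatKernel :
    Measurable fun z : ℝ × EuclideanSpace ℝ (Fin N) => heatKernel z.1 z.2 := by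
  unfold heatKernel; fun_prop

theorem integral_heatKernel_rpow {t s : ℝ} (ht : 0 < t) (hs : 0 < s) :
    ∫ x : EuclideanSpace ℝ (Fin N), heatKernel t x ^ s =
      s ^ (-((N : ℝ) / 2)) * (4 * π * t) ^ (-((N : ℝ) / 2) * (s - 1)) := by
  have h1 : ∀ x : EuclideanSpace ℝ (Fin N), heatKernel t x ^ s =
      (4 * π * t) ^ (-((N : ℝ) / 2) * s) * exp (-((4 * t)⁻¹ * s) * ‖x‖ ^ 2) := by
    intro x
    unfold heatKernel
    rw [mul_rpow (by positivity) (by positivity), ← rpow_mul (by positivity), ← exp_mul]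
    congr 2
    ring
  simp_rw [h1]
  rw [integral_const_mul, GaussianFourier.integral_rexp_neg_mul_sq_norm (by positivity)]
  have h2 : π / ((4 * t)⁻¹ * s) = (4 * π * t) * s⁻¹ := by field_simp
  rw [h2, mul_rpow (x := 4 * π * t) (by positivity) (by positivity), finrank_euclideanSpace_fin,
    inv_rpow hs.le, ← rpow_neg hs.le, ← mul_assoc, ← rpow_add (by positivity), mul_comm]
  congr 2
  ring

theorem integrable_heatKernel_rpow {t s : ℝ} (ht : 0 < t) (hs : 0 < s) :
    Integrable fun x : EuclideanSpace ℝ (Fin N) => heatKernel t x ^ s := by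
  refine Integrable.of_integral_ne_zero ?_
  rw [integral_heatKernel_rpow ht hs]
  positivity

theorem fourier_heatKernel {t : ℝ} (ht : 0 < t) (ξ : EuclideanSpace ℝ (Fin N)) :
    FourierTransform.fourier (fun x : EuclideanSpace ℝ (Fin N) => (heatKernel t x : ℂ)) ξ =
      (exp (-t * ‖(2 * π) • ξ‖ ^ 2) : ℂ) := by
  have hb : 0 < ((((4 * t)⁻¹ : ℝ) : ℂ)).re := by
    rw [Complex.ofReal_re]; positivity
  have h := fourier_gaussian_innerProductSpace hb ξ
  have e : (fun x : EuclideanSpace ℝ (Fin N) => (heatKernel t x : ℂ)) =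
      (((4 * π * t) ^ (-((N : ℝ) / 2)) : ℝ) : ℂ) •
        fun x : EuclideanSpace ℝ (Fin N) => Complex.exp (-((4 * t)⁻¹ : ℝ) * ‖x‖ ^ 2) := by
    ext x
    simp [heatKernel]
  have e2 : FourierTransform.fourier (fun x : EuclideanSpace ℝ (Fin N) => (heatKernel t x : ℂ)) ξ =
      (((4 * π * t) ^ (-((N : ℝ) / 2)) : ℝ) : ℂ) * FourierTransform.fourier
        (fun x : EuclideanSpace ℝ (Fin N) => Complex.exp (-((4 * t)⁻¹ : ℝ) * ‖x‖ ^ 2)) ξ := by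
    rw [e]
    simp only [Real.fourier_eq, Pi.smul_apply, smul_eq_mul]
    rw [← integral_const_mul]
    congr 1 with x
    simp only [Circle.smul_def, smul_eq_mul]
    ring
  rw [e2, h, finrank_euclideanSpace_fin]
  have h3 : ((π : ℂ) / ((4 * t)⁻¹ : ℝ)) ^ ((N : ℂ) / 2) =
      (((4 * π * t) ^ ((N : ℝ) / 2) : ℝ) : ℂ) := by
    rw [Complex.ofReal_cpow (by positivity)]
    congr 1
    · push_cast
      field_simp
    · push_cast; rfl
  rw [h3, ← mul_assoc, ← Complex.ofReal_mul, ← rpow_add (by positivity)]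
  simp only [neg_add_cancel, rpow_zero, Complex.ofReal_one, one_mul]
  rw [norm_smul, Real.norm_eq_abs, abs_of_pos (by positivity)]
  push_cast
  congr 1
  field_simp
  ring

/-- The weight in the subordination formula for `(1 + |ξ|²)^{-1/2}`. -/
def besselWeight (t : ℝ) : ℝ := π ^ (-(1 / 2) : ℝ) * (t ^ (-(1 / 2) : ℝ) * exp (-t))

theorem besselWeight_pos {t : ℝ} (ht : 0 < t) : 0 < besselWeight t := by
  unfold besselWeight; positivity

theorem measurable_besselWeight : Measurable besselWeight := by
  unfold besselWeight; fun_prop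

/-- Euler's integral with Γ(1/2) = √π, which cancels the factor π^{-1/2} in the weight. -/
theorem integral_besselWeight_mul_exp {r : ℝ} (hr : 0 ≤ r) :
    ∫ t in Ioi (0 : ℝ), besselWeight t * exp (-t * r) = (1 + r) ^ (-(1 / 2) : ℝ) := by
  have h := Real.integral_rpow_mul_exp_neg_mul_Ioi (a := 1 / 2) (r := 1 + r) (by norm_num)
    (by positivity)
  have e : ∀ t : ℝ, besselWeight t * exp (-t * r) =
      π ^ (-(1 / 2) : ℝ) * (t ^ ((1 / 2 : ℝ) - 1) * exp (-((1 + r) * t))) := by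
    intro t
    unfold besselWeight
    rw [mul_assoc, mul_assoc, ← exp_add]
    congr 2
    · norm_num
    · ring_nf
  simp_rw [e]
  rw [integral_const_mul, h, Gamma_one_half_eq, sqrt_eq_rpow, one_div (1 + r), inv_rpow (by positivity),
    ← rpow_neg (by positivity), mul_left_comm, ← rpow_add pi_pos]
  norm_num

theorem integrableOn_besselWeight : IntegrableOn besselWeight (Ioi 0) := by
  refine Integrable.of_integral_ne_zero ?_
  have := integral_besselWeight_mul_exp (le_refl 0)
  simp only [mul_zero, exp_zero, mul_one, add_zero, one_rpow] at this
  rw [this]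
  exact one_ne_zero

/-- The kernel of `(1 - Δ)^{-1/2}`. -/
def besselKernel (x : EuclideanSpace ℝ (Fin N)) : ℝ :=
  ∫ t in Ioi (0 : ℝ), besselWeight t * heatKernel t x

theorem measurable_besselIntegrand :
    Measurable fun z : ℝ × EuclideanSpace ℝ (Fin N) => besselWeight z.1 * heatKernel z.1 z.2 :=
  (measurable_besselWeight.comp measurable_fst).mul measurable_heatKernel

theorem integrable_besselIntegrand :
    Integrable (fun z : ℝ × EuclideanSpace ℝ (Fin N) => besselWeight z.1 * heatKernel z.1 z.2)
      ((volume.restrict (Ioi 0)).prod volume) := by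
  have h1 : ∀ t : ℝ, 0 < t → Integrable (heatKernel (N := N) t) ∧
      ∫ x : EuclideanSpace ℝ (Fin N), heatKernel t x = 1 := fun t ht => by
    have h2 := integrable_heatKernel_rpow (N := N) ht one_pos
    have h3 := integral_heatKernel_rpow (N := N) ht one_pos
    simp only [rpow_one, sub_self, mul_zero, rpow_zero, one_rpow, mul_one] at h2 h3
    exact ⟨h2, h3⟩
  rw [integrable_prod_iff measurable_besselIntegrand.aestronglyMeasurable]
  constructor
  · filter_upwards [ae_restrict_mem measurableSet_Ioi] with t ht
    exact (h1 t ht).1.const_mul _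
  · refine integrableOn_besselWeight.congr ?_
    filter_upwards [ae_restrict_mem measurableSet_Ioi] with t ht
    simp only [norm_mul, Real.norm_eq_abs, abs_of_pos (besselWeight_pos ht),
      abs_of_pos (heatKernel_pos ht _)]
    rw [integral_const_mul, (h1 t ht).2, mul_one]

theorem integrable_besselKernel : Integrable (besselKernel (N := N)) :=
  integrable_besselIntegrand.integral_prod_right

theorem measurable_besselKernel : Measurable (besselKernel (N := N)) := by
  have := StronglyMeasurable.integral_prod_left
    (f := fun t (x : EuclideanSpace ℝ (Fin N)) => besselWeight t * heatKernel t x)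
    (μ := volume.restrict (Ioi 0)) measurable_besselIntegrand.stronglyMeasurable
  exact this.measurable

/-- Fubini reduces the transform to those of the heat kernels, e^{-t|2πξ|²}, and the subordination
formula averages these to the symbol. -/
theorem fourier_besselKernel (ξ : EuclideanSpace ℝ (Fin N)) :
    FourierTransform.fourier (fun x : EuclideanSpace ℝ (Fin N) => (besselKernel x : ℂ)) ξ =
      besselSymbol ξ := by
  have hint : Integrable (fun z : ℝ × EuclideanSpace ℝ (Fin N) =>
      fourierChar (-inner ℝ z.2 ξ) • ((besselWeight z.1 * heatKernel z.1 z.2 : ℝ) : ℂ))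
      ((volume.restrict (Ioi 0)).prod volume) := by
    refine (integrable_besselIntegrand.ofReal (𝕜 := ℂ)).mono ?_ (ae_of_all _ fun z => ?_)
    · refine AEStronglyMeasurable.smul ?_
        (integrable_besselIntegrand.ofReal (𝕜 := ℂ)).aestronglyMeasurable
      have : Continuous fun z : ℝ × EuclideanSpace ℝ (Fin N) => -inner ℝ z.2 ξ := by fun_prop
      exact (continuous_subtype_val.comp (continuous_fourierChar.comp this)).aestronglyMeasurable
    · rw [Circle.norm_smul]; rfl
  rw [Real.fourier_eq]
  have e1 : ∀ x : EuclideanSpace ℝ (Fin N),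
      fourierChar (-inner ℝ x ξ) • (besselKernel x : ℂ) =
      ∫ t in Ioi (0 : ℝ), fourierChar (-inner ℝ x ξ) •
        ((besselWeight t * heatKernel t x : ℝ) : ℂ) := by
    intro x
    simp only [Circle.smul_def]
    rw [integral_smul, besselKernel]
    congr 1
    exact (integral_ofReal (𝕜 := ℂ)).symm
  simp_rw [e1]
  rw [← integral_integral_swap hint]
  have e2 : ∀ t ∈ Ioi (0 : ℝ), ∫ x : EuclideanSpace ℝ (Fin N), fourierChar (-inner ℝ x ξ) •
        ((besselWeight t * heatKernel t x : ℝ) : ℂ) =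
      ((besselWeight t * exp (-t * ‖(2 * π) • ξ‖ ^ 2) : ℝ) : ℂ) := by
    intro t ht
    have h := fourier_heatKernel ht ξ
    rw [Real.fourier_eq] at h
    push_cast
    push_cast at h
    rw [← h, ← integral_const_mul]
    congr 1 with x
    simp only [Circle.smul_def, smul_eq_mul]
    ring
  rw [setIntegral_congr_fun measurableSet_Ioi e2]
  refine (integral_ofReal (𝕜 := ℂ)).trans ?_
  exact congrArg (fun r : ℝ => (r : ℂ)) (integral_besselWeight_mul_exp (by positivity))

theorem lintegral_besselWeight_rpow_lt_top {a : ℝ} (ha : -(1 / 2) < a) :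
    ∫⁻ t in Ioi (0 : ℝ), ENNReal.ofReal (besselWeight t * t ^ a) < ∞ := by
  have h := (GammaIntegral_convergent (s := a + 1 / 2) (by linarith)).const_mul
    (π ^ (-(1 / 2) : ℝ))
  have h2 : IntegrableOn (fun t : ℝ => besselWeight t * t ^ a) (Ioi 0) := by
    refine IntegrableOn.congr_fun h (fun t ht => ?_) measurableSet_Ioi
    have ht : (0 : ℝ) < t := ht
    have e : t ^ (a + 1 / 2 - 1) = t ^ (-(1 / 2) : ℝ) * t ^ a := by
      rw [← rpow_add ht]; congr 1; ring
    simp only [besselWeight, e]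
    ring
  exact h2.lintegral_lt_top

theorem lintegral_heatKernel_rpow {t s : ℝ} (ht : 0 < t) (hs : 0 < s) :
    ∫⁻ x : EuclideanSpace ℝ (Fin N), ENNReal.ofReal (heatKernel t x ^ s) =
      ENNReal.ofReal
        (s ^ (-((N : ℝ) / 2)) * (4 * π * t) ^ (-((N : ℝ) / 2) * (s - 1))) := by
  rw [← integral_heatKernel_rpow ht hs, ofReal_integral_eq_lintegral_ofReal
    (integrable_heatKernel_rpow ht hs)
    (ae_of_all _ fun x => rpow_nonneg (heatKernel_pos ht x).le _)]

/-- The s-th power integral of the heat kernel is a multiple of t^{-(N/2)(s-1)}, and (s - 1)(q - 1)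
= 1, so N < q keeps the singularity at t = 0 integrable. Hölder in t, balanced by powers of t,
brings the s-th power inside the t-integral, and Tonelli then allows integrating in x first. -/
theorem lintegral_besselKernel_rpow_lt_top {q s : ℝ} (hs : q.HolderConjugate s)
    (hq : (N : ℝ) < q) :
    ∫⁻ x : EuclideanSpace ℝ (Fin N), ‖besselKernel x‖ₑ ^ s < ∞ := by
  have hq1 : 1 < q := hs.lt
  have hs1 : 1 < s := hs.symm.lt
  have hq0 : 0 < q := hs.pos
  have hs0 : 0 < s := hs.symm.pos
  -- The midpoint of the admissible interval (1/2 - (q - N)/2, 1/2): the upper bound makes the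
  -- integral of w t^{-θ} finite, the lower bound that of w t^{(θ - N/2)(s-1)}, where w is
  -- `besselWeight`.
  set θ : ℝ := 1 / 2 - (q - N) / 4 with hθ
  have hC₁ := lintegral_besselWeight_rpow_lt_top (a := -θ) (by rw [hθ]; linarith)
  set C₁ := ∫⁻ t in Ioi (0 : ℝ), ENNReal.ofReal (besselWeight t * t ^ (-θ)) with hC₁def
  have hm : Measurable fun z : ℝ × EuclideanSpace ℝ (Fin N) =>
      ENNReal.ofReal (besselWeight z.1 * z.1 ^ (θ * (s - 1)) * heatKernel z.1 z.2 ^ s) := by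
    have h1 : Measurable fun z : ℝ × EuclideanSpace ℝ (Fin N) => besselWeight z.1 :=
      measurable_besselWeight.comp measurable_fst
    have h2 := measurable_heatKernel (N := N)
    fun_prop
  have hqs : 1 / q = 1 - 1 / s := by
    have := hs.inv_add_inv_eq_one
    simp only [one_div]; linarith
  have hsq : s * (1 / q) = s - 1 := by rw [hqs]; field_simp
  have pointwise : ∀ x : EuclideanSpace ℝ (Fin N), ‖besselKernel x‖ₑ ^ s ≤
      C₁ ^ (s - 1) * ∫⁻ t in Ioi (0 : ℝ),
        ENNReal.ofReal (besselWeight t * t ^ (θ * (s - 1)) * heatKernel t x ^ s) := by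
    intro x
    have hx : Measurable fun t : ℝ => heatKernel t x :=
      measurable_heatKernel.comp (measurable_id.prodMk measurable_const)
    have hw := measurable_besselWeight
    -- The splitting w h = (w t^{-θ})^{1/q} · (w^{1/s} t^{θ/q} h), prepared for Hölder with
    -- exponents q and s.
    have h1 : ‖besselKernel x‖ₑ ≤ ∫⁻ t in Ioi (0 : ℝ),
        ENNReal.ofReal ((besselWeight t * t ^ (-θ)) ^ (1 / q)) *
        ENNReal.ofReal (besselWeight t ^ (1 / s) * t ^ (θ / q) * heatKernel t x) := by
      refine (enorm_integral_le_lintegral_enorm _).trans (le_of_eq ?_)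
      refine setLIntegral_congr_fun measurableSet_Ioi fun t ht => ?_
      have ht : (0 : ℝ) < t := ht
      have hwt := besselWeight_pos ht
      have hht := heatKernel_pos ht x
      rw [Real.enorm_eq_ofReal (by positivity), ← ENNReal.ofReal_mul (by positivity)]
      congr 1
      have e : besselWeight t = besselWeight t ^ (1 / q) * besselWeight t ^ (1 / s) := by
        rw [← rpow_add hwt, hqs]; simp
      rw [mul_rpow hwt.le (by positivity), ← rpow_mul ht.le]
      have e2 : t ^ (-θ * (1 / q)) * t ^ (θ / q) = 1 := by
        rw [← rpow_add ht]
        have : -θ * (1 / q) + θ / q = 0 := by ring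
        rw [this, rpow_zero]
      calc besselWeight t * heatKernel t x
          = besselWeight t ^ (1 / q) * besselWeight t ^ (1 / s) * heatKernel t x * 1 := by
            rw [← e, mul_one]
        _ = besselWeight t ^ (1 / q) * besselWeight t ^ (1 / s) * heatKernel t x *
            (t ^ (-θ * (1 / q)) * t ^ (θ / q)) := by rw [e2]
        _ = _ := by ring
    have h2 := ENNReal.lintegral_mul_le_Lp_mul_Lq (volume.restrict (Ioi (0 : ℝ))) hs
      (f := fun t => ENNReal.ofReal ((besselWeight t * t ^ (-θ)) ^ (1 / q)))
      (g := fun t => ENNReal.ofReal (besselWeight t ^ (1 / s) * t ^ (θ / q) * heatKernel t x))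
      (by fun_prop) (by fun_prop)
    have h3 := h1.trans h2
    have e3 : ∫⁻ t in Ioi (0 : ℝ),
        ENNReal.ofReal ((besselWeight t * t ^ (-θ)) ^ (1 / q)) ^ q = C₁ := by
      refine setLIntegral_congr_fun measurableSet_Ioi fun t ht => ?_
      have ht : (0 : ℝ) < t := ht
      have hwt := besselWeight_pos ht
      rw [ENNReal.ofReal_rpow_of_pos (by positivity), ← rpow_mul (by positivity)]
      simp [hq0.ne']
    have e4 : ∫⁻ t in Ioi (0 : ℝ),
        ENNReal.ofReal (besselWeight t ^ (1 / s) * t ^ (θ / q) * heatKernel t x) ^ s =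
        ∫⁻ t in Ioi (0 : ℝ),
        ENNReal.ofReal (besselWeight t * t ^ (θ * (s - 1)) * heatKernel t x ^ s) := by
      refine setLIntegral_congr_fun measurableSet_Ioi fun t ht => ?_
      have ht : (0 : ℝ) < t := ht
      have hwt := besselWeight_pos ht
      have hht := heatKernel_pos ht x
      rw [ENNReal.ofReal_rpow_of_pos (by positivity), mul_rpow (by positivity) hht.le,
        mul_rpow (by positivity) (by positivity), ← rpow_mul hwt.le, ← rpow_mul ht.le]
      have : θ / q * s = θ * (s - 1) := by rw [← hsq]; ring
      rw [this]
      simp [hs0.ne']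
    rw [e3, e4] at h3
    calc ‖besselKernel x‖ₑ ^ s ≤ _ := ENNReal.rpow_le_rpow h3 hs0.le
      _ = _ := by
        rw [ENNReal.mul_rpow_of_nonneg _ _ hs0.le, ← ENNReal.rpow_mul, ← ENNReal.rpow_mul,
          one_div_mul_cancel hs0.ne', ENNReal.rpow_one, mul_comm (1 / q), hsq]
  refine (lintegral_mono pointwise).trans_lt ?_
  have hms : Measurable fun x : EuclideanSpace ℝ (Fin N) => ∫⁻ t in Ioi (0 : ℝ),
        ENNReal.ofReal (besselWeight t * t ^ (θ * (s - 1)) * heatKernel t x ^ s) :=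
    Measurable.lintegral_prod_left hm
  rw [lintegral_const_mul _ hms]
  refine ENNReal.mul_lt_top (ENNReal.rpow_lt_top_of_nonneg (by linarith) hC₁.ne) ?_
  rw [lintegral_lintegral_swap (f := fun (x : EuclideanSpace ℝ (Fin N)) (t : ℝ) =>
    ENNReal.ofReal (besselWeight t * t ^ (θ * (s - 1)) * heatKernel t x ^ s))
    (hm.comp measurable_swap).aemeasurable]
  have e5 : ∀ t ∈ Ioi (0 : ℝ), ∫⁻ x : EuclideanSpace ℝ (Fin N),
      ENNReal.ofReal (besselWeight t * t ^ (θ * (s - 1)) * heatKernel t x ^ s) =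
      ENNReal.ofReal (s ^ (-((N : ℝ) / 2)) * (4 * π) ^ (-((N : ℝ) / 2) * (s - 1))) *
        ENNReal.ofReal (besselWeight t * t ^ ((θ - N / 2) * (s - 1))) := by
    intro t ht
    have ht : (0 : ℝ) < t := ht
    have hwt := besselWeight_pos ht
    have hx : Measurable fun x : EuclideanSpace ℝ (Fin N) => heatKernel t x :=
      measurable_heatKernel.comp (measurable_const.prodMk measurable_id)
    simp_rw [ENNReal.ofReal_mul (show 0 ≤ besselWeight t * t ^ (θ * (s - 1)) by positivity)]
    rw [lintegral_const_mul _ (by fun_prop), lintegral_heatKernel_rpow ht hs0,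
      ← ENNReal.ofReal_mul (by positivity), ← ENNReal.ofReal_mul (by positivity)]
    congr 1
    have e6 : t ^ ((θ - N / 2) * (s - 1)) =
        t ^ (θ * (s - 1)) * t ^ (-((N : ℝ) / 2) * (s - 1)) := by
      rw [← rpow_add ht]; congr 1; ring
    rw [e6, mul_rpow (x := 4 * π) (by positivity) ht.le]
    ring
  rw [setLIntegral_congr_fun measurableSet_Ioi e5, lintegral_const_mul' _ _ ENNReal.ofReal_ne_top]
  refine ENNReal.mul_lt_top ENNReal.ofReal_lt_top (lintegral_besselWeight_rpow_lt_top ?_)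
  have hsq' : (s - 1) * (q - 1) = 1 := by
    have := hs.sub_one_mul_conj
    linarith
  have hs1' : 0 < s - 1 := by linarith
  have : (θ - N / 2) * (s - 1) - -(1 / 2) = (s - 1) * ((q - 1) / 2 + θ - N / 2) := by
    linear_combination (-1/2) * hsq'
  have h7 : 0 < (q - 1) / 2 + θ - N / 2 := by rw [hθ]; linarith
  have := mul_pos hs1' h7
  linarith

end BesselKernel

/-! ### Convolution with the Bessel kernel as an operator from L_{q/2} to L_q -/

section BesselConvolution

variable {N : ℕ}

/-- Young's inequality for convolutions. -/
theorem lintegral_convolution_rpow_le {f g : EuclideanSpace ℝ (Fin N) → ℝ≥0∞}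
    (hf : Measurable f) (hg : AEMeasurable g volume) {p q r : ℝ} (hp : 0 < p) (hq : 0 < q)
    (hr : 0 < r) (hpr : p ≤ r) (hqr : q ≤ r) (hpqr : p⁻¹ + q⁻¹ = 1 + r⁻¹) :
    ∫⁻ x, (∫⁻ y, f (x - y) * g y) ^ r ≤
      (∫⁻ x, f x ^ p) ^ (r / p) * (∫⁻ x, g x ^ q) ^ (r / q) := by
  set F := ∫⁻ x, f x ^ p with hF
  set G := ∫⁻ x, g x ^ q with hG
  have hpr' : 0 ≤ p⁻¹ - r⁻¹ := sub_nonneg.2 (inv_anti₀ hp hpr)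
  have hqr' : 0 ≤ q⁻¹ - r⁻¹ := sub_nonneg.2 (inv_anti₀ hq hqr)
  have hmf : ∀ x, Measurable fun y => f (x - y) := fun x =>
    hf.comp (measurable_const.sub measurable_id)
  have pointwise : ∀ x, (∫⁻ y, f (x - y) * g y) ^ r ≤
      (∫⁻ y, f (x - y) ^ p * g y ^ q) * (F ^ (r / p - 1) * G ^ (r / q - 1)) := by
    intro x
    -- Hölder for three factors, fg = (f^p g^q)^{1/r} (f^p)^{1/p-1/r} (g^q)^{1/q-1/r}, whose
    -- exponents sum to 1 by `hpqr`. Only the integral of the first factor still depends on x.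
    have h := ENNReal.lintegral_prod_norm_pow_le (μ := (volume : Measure (EuclideanSpace ℝ (Fin N))))
      (Finset.univ : Finset (Fin 3))
      (f := ![fun y => f (x - y) ^ p * g y ^ q, fun y => f (x - y) ^ p, fun y => g y ^ q])
      (p := ![r⁻¹, p⁻¹ - r⁻¹, q⁻¹ - r⁻¹])
      (by
        intro i _
        fin_cases i
        · exact ((hmf x).pow_const p).aemeasurable.mul (hg.pow_const q)
        · exact ((hmf x).pow_const p).aemeasurable
        · exact hg.pow_const q)
      (by simp [Fin.sum_univ_three]; linarith)
      (by
        intro i _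
        fin_cases i
        · exact inv_nonneg.2 hr.le
        · exact hpr'
        · exact hqr')
    simp only [Fin.prod_univ_three] at h
    change ∫⁻ y, (f (x - y) ^ p * g y ^ q) ^ r⁻¹ * (f (x - y) ^ p) ^ (p⁻¹ - r⁻¹) *
        (g y ^ q) ^ (q⁻¹ - r⁻¹) ≤ (∫⁻ y, f (x - y) ^ p * g y ^ q) ^ r⁻¹ *
        (∫⁻ y, f (x - y) ^ p) ^ (p⁻¹ - r⁻¹) * G ^ (q⁻¹ - r⁻¹) at h
    have e : ∀ y, (f (x - y) ^ p * g y ^ q) ^ r⁻¹ * (f (x - y) ^ p) ^ (p⁻¹ - r⁻¹) *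
        (g y ^ q) ^ (q⁻¹ - r⁻¹) = f (x - y) * g y := by
      intro y
      have aux : ∀ (u : ℝ≥0∞) {a : ℝ}, 0 < a → 0 ≤ a⁻¹ - r⁻¹ →
          (u ^ a) ^ r⁻¹ * (u ^ a) ^ (a⁻¹ - r⁻¹) = u := fun u a ha ha' => by
        rw [← ENNReal.rpow_add_of_nonneg _ _ (inv_nonneg.2 hr.le) ha', ← ENNReal.rpow_mul]
        have : a * (r⁻¹ + (a⁻¹ - r⁻¹)) = 1 := by
          field_simp
          ring
        rw [this, ENNReal.rpow_one]
      rw [ENNReal.mul_rpow_of_nonneg _ _ (inv_nonneg.2 hr.le)]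
      calc _ = ((f (x - y) ^ p) ^ r⁻¹ * (f (x - y) ^ p) ^ (p⁻¹ - r⁻¹)) *
            ((g y ^ q) ^ r⁻¹ * (g y ^ q) ^ (q⁻¹ - r⁻¹)) := by ring
        _ = _ := by rw [aux _ hp hpr', aux _ hq hqr']
    simp_rw [e] at h
    have eF : ∫⁻ y, f (x - y) ^ p = F := lintegral_sub_left_eq_self (fun y => f y ^ p) x
    rw [eF] at h
    calc _ ≤ _ := ENNReal.rpow_le_rpow h hr.le
      _ = _ := by
        rw [ENNReal.mul_rpow_of_nonneg _ _ hr.le, ENNReal.mul_rpow_of_nonneg _ _ hr.le,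
          ← ENNReal.rpow_mul, ← ENNReal.rpow_mul, ← ENNReal.rpow_mul, inv_mul_cancel₀ hr.ne',
          ENNReal.rpow_one, mul_assoc]
        congr 3 <;> field_simp
  have hmeas : AEMeasurable (fun z : EuclideanSpace ℝ (Fin N) × EuclideanSpace ℝ (Fin N) =>
      f (z.1 - z.2) ^ p * g z.2 ^ q) (volume.prod volume) :=
    ((hf.comp (measurable_fst.sub measurable_snd)).pow_const p).aemeasurable.mul
      ((hg.pow_const q).comp_snd)
  refine (lintegral_mono pointwise).trans (le_of_eq ?_)
  rw [lintegral_mul_const'' _ hmeas.lintegral_prod_right', lintegral_lintegral_swap hmeas]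
  have e2 : ∀ y, ∫⁻ x, f (x - y) ^ p * g y ^ q = F * g y ^ q := by
    intro y
    have hm : Measurable fun x => f (x - y) := hf.comp (measurable_id.sub measurable_const)
    rw [lintegral_mul_const _ (hm.pow_const p)]
    congr 1
    exact lintegral_sub_right_eq_self (fun x => f x ^ p) y
  simp_rw [e2]
  rw [lintegral_const_mul'' _ (hg.pow_const q), ← hG]
  have aux : ∀ (u : ℝ≥0∞) {a : ℝ}, 0 < a → a ≤ r → u * u ^ (r / a - 1) = u ^ (r / a) :=
    fun u a ha har => by
      have : 0 ≤ r / a - 1 := sub_nonneg.2 ((one_le_div ha).2 har)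
      conv_lhs => rw [← ENNReal.rpow_one u, ← ENNReal.rpow_mul, one_mul]
      rw [← ENNReal.rpow_add_of_nonneg _ _ zero_le_one this]
      congr 1
      ring
  calc _ = (F * F ^ (r / p - 1)) * (G * G ^ (r / q - 1)) := by ring
    _ = _ := by rw [aux _ hp hpr, aux _ hq hqr]

/-- Convolution with the kernel of `(1 - Δ)^{-1/2}`. -/
def besselConv (u : EuclideanSpace ℝ (Fin N) → ℝ) (x : EuclideanSpace ℝ (Fin N)) : ℝ :=
  ∫ y, besselKernel (x - y) * u y

/-- Young's inequality with the kernel in L_{q/(q-1)}, as (1 - 1/q) + 2/q = 1 + 1/q. The bound is on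
the integral of absolute values, so it also yields absolute convergence of the convolution almost
everywhere. -/
theorem exists_lintegral_besselConv_le {q : ℝ≥0∞} (hN : 2 ≤ N) (hq : (N : ℝ≥0∞) < q)
    (hq' : q < ∞) : ∃ C : ℝ≥0, ∀ u : EuclideanSpace ℝ (Fin N) → ℝ,
      AEStronglyMeasurable u volume →
      (∫⁻ x, (∫⁻ y, ‖besselKernel (x - y) * u y‖ₑ) ^ q.toReal) ^ (1 / q.toReal) ≤
        C * eLpNorm u (q / 2) volume := by
  have hNq : (N : ℝ) < q.toReal := by
    simpa using (ENNReal.toReal_lt_toReal (ENNReal.natCast_ne_top N) hq'.ne).2 hq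
  have hN' : (2 : ℝ) ≤ N := by exact_mod_cast hN
  set Q := q.toReal with hQ
  have hQ2 : 2 < Q := by linarith
  have hs : Q.HolderConjugate (Q.conjExponent) := .conjExponent (by linarith)
  set s := Q.conjExponent with hsdef
  have hs0 : 0 < s := hs.symm.pos
  have hK := lintegral_besselKernel_rpow_lt_top (N := N) hs hNq
  have hinv := hs.inv_add_inv_eq_one
  have hsQ : s ≤ Q := by
    have h1 : s⁻¹ = 1 - Q⁻¹ := by linarith
    have h2 : Q⁻¹ ≤ 2⁻¹ := inv_anti₀ (by norm_num) hQ2.le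
    refine (inv_le_inv₀ (by linarith) hs0).1 ?_
    rw [h1]; linarith
  have hQ2' : (Q / 2)⁻¹ = 2 * Q⁻¹ := by rw [inv_div]; rfl
  refine ⟨((∫⁻ x : EuclideanSpace ℝ (Fin N), ‖besselKernel x‖ₑ ^ s) ^ (1 / s)).toNNReal,
    fun u hu => ?_⟩
  rw [ENNReal.coe_toNNReal (ENNReal.rpow_lt_top_of_nonneg (by positivity) hK.ne).ne]
  have h := lintegral_convolution_rpow_le (N := N) (f := fun x => ‖besselKernel x‖ₑ)
    (g := fun x => ‖u x‖ₑ) measurable_besselKernel.enorm hu.enorm hs0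
    (show 0 < Q / 2 by linarith) (show 0 < Q by linarith) hsQ (by linarith)
    (by rw [hQ2']; linarith)
  have hq0 : q / 2 ≠ 0 := by simp [(lt_of_le_of_lt (zero_le) hq).ne']
  have hqt : q / 2 ≠ ∞ := (ENNReal.div_lt_top hq'.ne (by norm_num)).ne
  rw [eLpNorm_eq_lintegral_rpow_enorm_toReal hq0 hqt, ENNReal.toReal_div]
  simp only [enorm_mul, ENNReal.toReal_ofNat]
  calc _ ≤ _ := ENNReal.rpow_le_rpow h (by positivity)
    _ = _ := by
      rw [ENNReal.mul_rpow_of_nonneg _ _ (by positivity), ← ENNReal.rpow_mul, ← ENNReal.rpow_mul]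
      have e1 : Q / s * (1 / q.toReal) = 1 / s := by rw [← hQ]; field_simp
      have e2 : Q / (Q / 2) * (1 / q.toReal) = 1 / (q.toReal / 2) := by rw [← hQ]; field_simp
      rw [e1, e2]

section

variable {q : ℝ≥0∞} {u : EuclideanSpace ℝ (Fin N) → ℝ}

theorem aestronglyMeasurable_besselIntegrand (hu : AEStronglyMeasurable u volume) :
    AEStronglyMeasurable (fun z : EuclideanSpace ℝ (Fin N) × EuclideanSpace ℝ (Fin N) =>
      besselKernel (z.1 - z.2) * u z.2) (volume.prod volume) :=
  (measurable_besselKernel.comp (measurable_fst.sub measurable_snd)).aestronglyMeasurable.mul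
    hu.comp_snd

theorem lintegral_besselConv_lt_top (hN : 2 ≤ N) (hq : (N : ℝ≥0∞) < q) (hq' : q < ∞)
    (hu : MemLp u (q / 2) volume) :
    ∫⁻ x, (∫⁻ y, ‖besselKernel (x - y) * u y‖ₑ) ^ q.toReal < ∞ := by
  obtain ⟨C, hC⟩ := exists_lintegral_besselConv_le hN hq hq'
  have h := (hC u hu.1).trans_lt (ENNReal.mul_lt_top ENNReal.coe_lt_top hu.2)
  have hq0 : 0 < q.toReal := ENNReal.toReal_pos (lt_of_le_of_lt (zero_le) hq).ne' hq'.ne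
  by_contra hcon
  rw [not_lt, top_le_iff] at hcon
  rw [hcon, ENNReal.top_rpow_of_pos (by positivity)] at h
  exact lt_irrefl _ h

theorem ae_integrable_besselConv (hN : 2 ≤ N) (hq : (N : ℝ≥0∞) < q) (hq' : q < ∞)
    (hu : MemLp u (q / 2) volume) :
    ∀ᵐ x, Integrable fun y => besselKernel (x - y) * u y := by
  have hq0 : 0 < q.toReal := ENNReal.toReal_pos (lt_of_le_of_lt (zero_le) hq).ne' hq'.ne
  have hm := (aestronglyMeasurable_besselIntegrand hu.1)
  have h := ae_lt_top' ((hm.enorm.lintegral_prod_right').pow_const q.toReal)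
    (lintegral_besselConv_lt_top hN hq hq' hu).ne
  filter_upwards [h, hm.prodMk_left] with x hx hmx
  refine ⟨hmx, ?_⟩
  by_contra hcon
  rw [hasFiniteIntegral_iff_enorm, not_lt, top_le_iff] at hcon
  rw [hcon, ENNReal.top_rpow_of_pos hq0] at hx
  exact lt_irrefl _ hx

theorem aestronglyMeasurable_besselConv (hu : AEStronglyMeasurable u volume) :
    AEStronglyMeasurable (besselConv u) volume :=
  (aestronglyMeasurable_besselIntegrand hu).integral_prod_right'

theorem exists_eLpNorm_besselConv_le (hN : 2 ≤ N) (hq : (N : ℝ≥0∞) < q)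
    (hq' : q < ∞) : ∃ C : ℝ≥0, ∀ u : EuclideanSpace ℝ (Fin N) → ℝ,
      AEStronglyMeasurable u volume →
      eLpNorm (besselConv u) q volume ≤ C * eLpNorm u (q / 2) volume := by
  obtain ⟨C, hC⟩ := exists_lintegral_besselConv_le hN hq hq'
  refine ⟨C, fun u hu => le_trans ?_ (hC u hu)⟩
  rw [eLpNorm_eq_lintegral_rpow_enorm_toReal (lt_of_le_of_lt (zero_le) hq).ne' hq'.ne]
  gcongr with x
  exact enorm_integral_le_lintegral_enorm _

/-- This is the transposed multiplier acting on a Schwartz function. Moving the Fourier transform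
from one factor of the integral to the other replaces the symbol by the kernel whose transform it
is. -/
theorem fourier_besselSymbol_smul_fourierInv (φ : 𝓢(EuclideanSpace ℝ (Fin N), ℂ))
    (x : EuclideanSpace ℝ (Fin N)) :
    (FourierTransform.fourier (SchwartzMap.smulLeftCLM ℂ besselSymbol
      (FourierTransformInv.fourierInv φ))) x = ∫ y, (besselKernel y : ℂ) * φ (x + y) := by
  set ψ := FourierTransformInv.fourierInv φ with hψ
  have hφψ : φ = FourierTransform.fourier ψ := by simp [hψ]
  rw [SchwartzMap.fourier_coe, Real.fourier_eq]
  set g : EuclideanSpace ℝ (Fin N) → ℂ := fun ξ => Real.fourierChar (-inner ℝ ξ x) • ψ ξ with hg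
  have hgi : Integrable g := by
    refine ψ.integrable.mono ?_ (ae_of_all _ fun ξ => by rw [hg, Circle.norm_smul])
    refine AEStronglyMeasurable.smul ?_ ψ.continuous.aestronglyMeasurable
    have : Continuous fun ξ : EuclideanSpace ℝ (Fin N) => -inner ℝ ξ x := by fun_prop
    exact (continuous_subtype_val.comp
      (Real.continuous_fourierChar.comp this)).aestronglyMeasurable
  have h := VectorFourier.integral_fourierIntegral_smul_eq_flip
    (L := innerₗ (EuclideanSpace ℝ (Fin N))) (μ := volume) (ν := volume)
    (f := fun y => (besselKernel y : ℂ)) (g := g)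
    Real.continuous_fourierChar continuous_inner
    (integrable_besselKernel.ofReal (𝕜 := ℂ)) hgi
  have h1 : ∀ ξ, VectorFourier.fourierIntegral Real.fourierChar volume
      (innerₗ (EuclideanSpace ℝ (Fin N))) (fun y => (besselKernel y : ℂ)) ξ = besselSymbol ξ :=
    fun ξ => fourier_besselKernel ξ
  have h2 : ∀ y, VectorFourier.fourierIntegral Real.fourierChar volume
      (innerₗ (EuclideanSpace ℝ (Fin N))).flip g y = φ (x + y) := by
    intro y
    rw [hφψ, SchwartzMap.fourier_coe, Real.fourier_eq]
    refine integral_congr_ae (ae_of_all _ fun ξ => ?_)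
    simp only [hg, LinearMap.flip_apply, innerₗ_apply_apply, inner_add_right, neg_add,
      AddChar.map_add_eq_mul, mul_smul, real_inner_comm y ξ]
    rw [smul_comm]
  simp only [h1, h2, smul_eq_mul] at h
  rw [← h]
  refine integral_congr_ae (ae_of_all _ fun ξ => ?_)
  simp only [hg, SchwartzMap.smulLeftCLM_apply_apply besselSymbol_hasTemperateGrowth,
    Circle.smul_def, smul_eq_mul]
  ring

/-- Hölder between φ in L_{q/(q-1)} and the convolution of absolute values in L_q; this licenses
Fubini in the identification with (1 - Δ)^{-1/2}. -/
theorem integrable_schwartz_mul_besselIntegrand (hN : 2 ≤ N) (hq : (N : ℝ≥0∞) < q) (hq' : q < ∞)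
    (hu : MemLp u (q / 2) volume) (φ : 𝓢(EuclideanSpace ℝ (Fin N), ℂ)) :
    Integrable (fun z : EuclideanSpace ℝ (Fin N) × EuclideanSpace ℝ (Fin N) =>
      φ z.1 * ((besselKernel (z.1 - z.2) * u z.2 : ℝ) : ℂ)) (volume.prod volume) := by
  have hNq : (N : ℝ) < q.toReal := by
    simpa using (ENNReal.toReal_lt_toReal (ENNReal.natCast_ne_top N) hq'.ne).2 hq
  have hN' : (2 : ℝ) ≤ N := by exact_mod_cast hN
  have hs : q.toReal.HolderConjugate q.toReal.conjExponent := .conjExponent (by linarith)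
  set s := q.toReal.conjExponent
  have hs0 : 0 < s := hs.symm.pos
  have hm := aestronglyMeasurable_besselIntegrand hu.1
  have hm2 : AEStronglyMeasurable
      (fun z : EuclideanSpace ℝ (Fin N) × EuclideanSpace ℝ (Fin N) =>
        φ z.1 * ((besselKernel (z.1 - z.2) * u z.2 : ℝ) : ℂ)) (volume.prod volume) :=
    (φ.continuous.comp continuous_fst).aestronglyMeasurable.mul
      (Complex.continuous_ofReal.comp_aestronglyMeasurable hm)
  refine ⟨hm2, ?_⟩
  rw [hasFiniteIntegral_iff_enorm, lintegral_prod _ hm2.enorm]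
  have e : ∀ x, ∫⁻ y, ‖φ x * ((besselKernel (x - y) * u y : ℝ) : ℂ)‖ₑ =
      ‖φ x‖ₑ * ∫⁻ y, ‖besselKernel (x - y) * u y‖ₑ := by
    intro x
    rw [← lintegral_const_mul' _ _ enorm_ne_top]
    congr 1 with y
    rw [enorm_mul]
    congr 1
    simp [← ofReal_norm]
  simp only [e]
  refine (ENNReal.lintegral_mul_le_Lp_mul_Lq volume hs.symm
    φ.continuous.enorm.measurable.aemeasurable hm.enorm.lintegral_prod_right').trans_lt ?_
  refine ENNReal.mul_lt_top ?_ ?_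
  · have h := lintegral_rpow_enorm_lt_top_of_eLpNorm_lt_top (p := ENNReal.ofReal s)
      (by simpa using hs0) ENNReal.ofReal_ne_top
      (φ.memLp (ENNReal.ofReal s) (volume : Measure (EuclideanSpace ℝ (Fin N)))).2
    rw [ENNReal.toReal_ofReal hs0.le] at h
    exact ENNReal.rpow_lt_top_of_nonneg (by positivity) h.ne
  · exact ENNReal.rpow_lt_top_of_nonneg (by positivity)
      (lintegral_besselConv_lt_top hN hq hq' hu).ne

/-- Convolution with the Bessel kernel is `(1 - Δ)^{-1/2}`. -/
theorem toDistribution_besselConv [Fact (1 ≤ q)] (hN : 2 ≤ N) (hq : (N : ℝ≥0∞) < q)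
    (hq' : q < ∞) (U v : Lp ℝ q (volume : Measure (EuclideanSpace ℝ (Fin N))))
    (hU : MemLp U (q / 2) volume) (hv : v =ᵐ[volume] besselConv U) :
    toDistribution v = besselHalf (toDistribution U) := by
  ext φ
  have hint := integrable_schwartz_mul_besselIntegrand hN hq hq' hU φ
  rw [besselHalf, TemperedDistribution.fourierMultiplierCLM_apply_apply, toDistribution,
    toDistribution, Lp.toTemperedDistribution_apply, Lp.toTemperedDistribution_apply]
  have l1 : ∫ x, φ x • Complex.ofRealCLM.compLp v x =
      ∫ x, ∫ y, φ x * ((besselKernel (x - y) * U y : ℝ) : ℂ) := by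
    refine integral_congr_ae ?_
    filter_upwards [Complex.ofRealCLM.coeFn_compLp v, hv] with x h1 h2
    rw [h1, h2, integral_const_mul]
    congr 1
    exact (integral_ofReal (𝕜 := ℂ)).symm
  have l2 : ∫ x, (FourierTransform.fourier (SchwartzMap.smulLeftCLM ℂ besselSymbol
      (FourierTransformInv.fourierInv φ))) x • Complex.ofRealCLM.compLp U x =
      ∫ y, ∫ x, φ x * ((besselKernel (x - y) * U y : ℝ) : ℂ) := by
    refine integral_congr_ae ?_
    filter_upwards [Complex.ofRealCLM.coeFn_compLp U] with y h1
    rw [h1, fourier_besselSymbol_smul_fourierInv, smul_eq_mul, ← integral_mul_const]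
    have h2 := integral_sub_right_eq_self (μ := volume)
      (fun x => (besselKernel x : ℂ) * φ (y + x) * Complex.ofRealCLM (U y)) y
    rw [← h2]
    congr 1 with x
    simp only [add_sub_cancel, Complex.ofRealCLM_apply, Complex.ofReal_mul]
    ring
  rw [l1, l2, integral_integral_swap hint]

end

end BesselConvolution

/-! ### Morrey's inequality on the whole space -/

section Morrey

open Filter Topology Convolution

variable {N : ℕ}

theorem lintegral_comp_add_smul (F : EuclideanSpace ℝ (Fin N) → ℝ≥0∞)
    (c : EuclideanSpace ℝ (Fin N)) {s : ℝ} (hs : 0 < s) :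
    ∫⁻ y, F (c + s • y) = ENNReal.ofReal ((s ^ N)⁻¹) * ∫⁻ y, F y := by
  have h1 : ∫⁻ y, F (c + s • y) = ∫⁻ z, F (c + z) ∂(Measure.map (s • ·) volume) :=
    ((Homeomorph.smulOfNeZero s hs.ne').measurableEmbedding.lintegral_map
      (fun z => F (c + z))).symm
  rw [h1, Measure.map_addHaar_smul _ hs.ne', lintegral_smul_measure,
    lintegral_add_left_eq_self F c, finrank_euclideanSpace_fin, abs_of_pos (by positivity)]
  rfl

/-- The substitution z = c + s y costs s^{-N}, and Hölder on the ball of radius s gains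
s^{N(1-1/q)}. -/
theorem lintegral_ball_comp_add_smul_le {q : ℝ≥0∞} (hq1 : 1 ≤ q) (hq' : q < ∞)
    {v : EuclideanSpace ℝ (Fin N) → ℝ} (hv : AEStronglyMeasurable v volume)
    (c : EuclideanSpace ℝ (Fin N)) {s : ℝ} (hs : 0 < s) :
    ∫⁻ y in Metric.ball 0 1, ‖v (c + s • y)‖ₑ ≤
      volume (Metric.ball (0 : EuclideanSpace ℝ (Fin N)) 1) ^ (1 - 1 / q.toReal) *
        ENNReal.ofReal (s ^ (-((N : ℝ) / q.toReal))) * eLpNorm v q volume := by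
  have hQ : 1 ≤ q.toReal := by
    simpa using (ENNReal.toReal_le_toReal ENNReal.one_ne_top hq'.ne).2 hq1
  have e1 : ∫⁻ y in Metric.ball 0 1, ‖v (c + s • y)‖ₑ =
      ∫⁻ y, (Metric.ball c s).indicator (fun z => ‖v z‖ₑ) (c + s • y) := by
    rw [← lintegral_indicator measurableSet_ball]
    congr 1 with y
    have : y ∈ Metric.ball (0 : EuclideanSpace ℝ (Fin N)) 1 ↔ c + s • y ∈ Metric.ball c s := by
      rw [mem_ball_zero_iff, mem_ball_iff_norm, add_sub_cancel_left, norm_smul,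
        Real.norm_eq_abs, abs_of_pos hs]
      exact ⟨fun h => by nlinarith, fun h => by nlinarith⟩
    by_cases hy : y ∈ Metric.ball (0 : EuclideanSpace ℝ (Fin N)) 1
    · rw [indicator_of_mem hy, indicator_of_mem (this.1 hy)]
    · rw [indicator_of_notMem hy, indicator_of_notMem (fun h => hy (this.2 h))]
  rw [e1, lintegral_comp_add_smul _ c hs, lintegral_indicator measurableSet_ball]
  have h2 := eLpNorm_le_eLpNorm_mul_rpow_measure_univ (μ := volume.restrict (Metric.ball c s))
    hq1 hv.restrict
  rw [eLpNorm_one_eq_lintegral_enorm, Measure.restrict_apply_univ, ENNReal.toReal_one,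
    Measure.addHaar_ball_of_pos _ _ hs, finrank_euclideanSpace_fin, div_one] at h2
  have h3 : eLpNorm v q (volume.restrict (Metric.ball c s)) ≤ eLpNorm v q volume :=
    eLpNorm_restrict_le _ _ _ _
  have hQ' : 0 ≤ 1 - 1 / q.toReal := by
    rw [sub_nonneg]
    exact (div_le_one (by linarith)).2 hQ
  calc _ ≤ ENNReal.ofReal ((s ^ N)⁻¹) * (eLpNorm v q volume *
        (ENNReal.ofReal (s ^ N) * volume (Metric.ball (0 : EuclideanSpace ℝ (Fin N)) 1)) ^
          (1 - 1 / q.toReal)) := by gcongr; exact h2.trans (by gcongr)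
    _ = _ := by
      rw [ENNReal.mul_rpow_of_nonneg _ _ hQ', ENNReal.ofReal_rpow_of_pos (by positivity)]
      have e3 : ENNReal.ofReal (s ^ (-((N : ℝ) / q.toReal))) =
          ENNReal.ofReal ((s ^ N)⁻¹) * ENNReal.ofReal ((s ^ N) ^ (1 - 1 / q.toReal)) := by
        rw [← ENNReal.ofReal_mul (by positivity)]
        congr 1
        rw [← Real.rpow_natCast, ← Real.rpow_neg hs.le, ← Real.rpow_mul hs.le,
          ← Real.rpow_add hs]
        congr 1
        ring
      rw [e3]
      ring

/-- A mollification is an average of translates, and the bound for v itself does not depend on the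
centre `c`. -/
theorem lintegral_ball_mollifier_le {q : ℝ≥0∞} (hq1 : 1 ≤ q) (hq' : q < ∞)
    {v : EuclideanSpace ℝ (Fin N) → ℝ} (hv : Measurable v)
    (ρ : ContDiffBump (0 : EuclideanSpace ℝ (Fin N)))
    (c : EuclideanSpace ℝ (Fin N)) {s : ℝ} (hs : 0 < s) :
    ∫⁻ y in Metric.ball 0 1, ‖∫ z, ρ.normed volume z * v (c + s • y - z)‖ₑ ≤
      volume (Metric.ball (0 : EuclideanSpace ℝ (Fin N)) 1) ^ (1 - 1 / q.toReal) *
        ENNReal.ofReal (s ^ (-((N : ℝ) / q.toReal))) * eLpNorm v q volume := by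
  set M := volume (Metric.ball (0 : EuclideanSpace ℝ (Fin N)) 1) ^ (1 - 1 / q.toReal) *
        ENNReal.ofReal (s ^ (-((N : ℝ) / q.toReal))) * eLpNorm v q volume with hM
  have hm : Measurable fun z : EuclideanSpace ℝ (Fin N) × EuclideanSpace ℝ (Fin N) =>
      ‖ρ.normed volume z.2 * v (c + s • z.1 - z.2)‖ₑ := by
    have := (ρ.continuous_normed (μ := volume)).measurable
    fun_prop
  calc _ ≤ ∫⁻ y in Metric.ball 0 1, ∫⁻ z, ‖ρ.normed volume z * v (c + s • y - z)‖ₑ :=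
        lintegral_mono fun y => enorm_integral_le_lintegral_enorm _
    _ = ∫⁻ z, ∫⁻ y in Metric.ball 0 1, ‖ρ.normed volume z * v (c + s • y - z)‖ₑ :=
        lintegral_lintegral_swap hm.aemeasurable
    _ ≤ ∫⁻ z, ‖ρ.normed volume z‖ₑ * M := by
        refine lintegral_mono fun z => ?_
        simp only [enorm_mul]
        rw [lintegral_const_mul' _ _ enorm_ne_top]
        gcongr
        have := lintegral_ball_comp_add_smul_le hq1 hq' hv.aestronglyMeasurable (c - z) hs
        simpa only [add_sub_right_comm] using this
    _ = M := by
        rw [lintegral_mul_const _ (ρ.continuous_normed.measurable.enorm)]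
        have : ∫⁻ z, ‖ρ.normed volume z‖ₑ = 1 := by
          have h := ofReal_integral_eq_lintegral_ofReal (ρ.integrable_normed (μ := volume))
            (ae_of_all _ ρ.nonneg_normed)
          rw [ρ.integral_normed, ENNReal.ofReal_one] at h
          rw [h]
          congr 1 with z
          exact Real.enorm_eq_ofReal (ρ.nonneg_normed z)
        rw [this, one_mul]

/-- The fundamental theorem of calculus on the segment from x to x + y, integrated over the unit
ball of y, where each |yᵢ| ≤ 1. -/
theorem enorm_mul_volume_ball_le {w : EuclideanSpace ℝ (Fin N) → ℝ} (hw : ContDiff ℝ 1 w)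
    (x : EuclideanSpace ℝ (Fin N)) :
    ‖w x‖ₑ * volume (Metric.ball (0 : EuclideanSpace ℝ (Fin N)) 1) ≤
      (∫⁻ y in Metric.ball 0 1, ‖w (x + y)‖ₑ) +
        ∑ i, ∫⁻ s in Ioc (0 : ℝ) 1, ∫⁻ y in Metric.ball 0 1,
          ‖fderiv ℝ w (x + s • y) (EuclideanSpace.single i 1)‖ₑ := by
  have hfd := hw.continuous_fderiv one_ne_zero
  have hcont : ∀ i, Continuous fun z : ℝ × EuclideanSpace ℝ (Fin N) =>
      fderiv ℝ w (x + z.1 • z.2) (EuclideanSpace.single i 1) := fun i =>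
    (hfd.comp (by fun_prop)).clm_apply continuous_const
  have pointwise : ∀ y ∈ Metric.ball (0 : EuclideanSpace ℝ (Fin N)) 1, ‖w x‖ₑ ≤ ‖w (x + y)‖ₑ +
      ∑ i, ∫⁻ s in Ioc (0 : ℝ) 1, ‖fderiv ℝ w (x + s • y) (EuclideanSpace.single i 1)‖ₑ := by
    intro y hy
    have hder : ∀ s : ℝ, HasDerivAt (fun s : ℝ => w (x + s • y)) (fderiv ℝ w (x + s • y) y) s := by
      intro s
      have h1 : HasDerivAt (fun s : ℝ => x + s • y) y s := by
        simpa using ((hasDerivAt_id s).smul_const y).const_add x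
      exact ((hw.differentiable one_ne_zero) (x + s • y)).hasFDerivAt.comp_hasDerivAt s h1
    have hc : Continuous fun s : ℝ => fderiv ℝ w (x + s • y) y :=
      (hfd.comp (by fun_prop)).clm_apply continuous_const
    have ftc := intervalIntegral.integral_eq_sub_of_hasDerivAt (fun s _ => hder s)
      (hc.intervalIntegrable 0 1)
    simp only [one_smul, zero_smul, add_zero] at ftc
    have e : w x = w (x + y) - ∫ s in (0 : ℝ)..1, fderiv ℝ w (x + s • y) y := by
      rw [ftc]; ring
    rw [e]
    refine (enorm_sub_le).trans ?_
    gcongr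
    rw [intervalIntegral.integral_of_le zero_le_one]
    refine (enorm_integral_le_lintegral_enorm _).trans ?_
    rw [← lintegral_finsetSum']
    · refine lintegral_mono fun s => ?_
      have hy2 : y = ∑ i, y i • EuclideanSpace.single i (1 : ℝ) := by
        have := (EuclideanSpace.basisFun (Fin N) ℝ).sum_repr y
        simpa using this.symm
      have e2 : ∀ L : EuclideanSpace ℝ (Fin N) →L[ℝ] ℝ,
          L y = ∑ i, y i * L (EuclideanSpace.single i 1) := fun L => by
        conv_lhs => rw [hy2, map_sum]
        simp
      simp only
      rw [e2]
      refine (enorm_sum_le _ _).trans (Finset.sum_le_sum fun i _ => ?_)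
      rw [enorm_mul]
      refine mul_le_of_le_one_left zero_le ?_
      have h3 : ‖y i‖ ≤ 1 := (PiLp.norm_apply_le y i).trans (mem_ball_zero_iff.1 hy).le
      rw [← ofReal_norm]
      simpa using h3
    · intro i _
      exact ((hcont i).comp (Continuous.prodMk_left y)).enorm.measurable.aemeasurable
  have hm1 : Measurable fun y : EuclideanSpace ℝ (Fin N) => ‖w (x + y)‖ₑ :=
    (hw.continuous.comp (by fun_prop)).enorm.measurable
  calc _ = ∫⁻ y in Metric.ball (0 : EuclideanSpace ℝ (Fin N)) 1, ‖w x‖ₑ := by simp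
    _ ≤ _ := setLIntegral_mono' measurableSet_ball pointwise
    _ = _ := by
      rw [lintegral_add_left hm1, lintegral_finsetSum']
      · congr 1
        refine Finset.sum_congr rfl fun i _ => ?_
        refine lintegral_lintegral_swap (f := fun (y : EuclideanSpace ℝ (Fin N)) (s : ℝ) =>
          ‖fderiv ℝ w (x + s • y) (EuclideanSpace.single i 1)‖ₑ) ?_
        exact ((hcont i).comp continuous_swap).enorm.measurable.aemeasurable
      · intro i _
        have := ((hcont i).comp continuous_swap).enorm.measurable
        exact (this.lintegral_prod_right' (ν := volume.restrict (Ioc 0 1))).aemeasurable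

/-- The derivative is put on the mollifier, and the weak derivative of u is then tested with y ↦ ρ(x
- y). -/
theorem fderiv_mollifier_of_hasWeakPartial {u v : EuclideanSpace ℝ (Fin N) → ℝ} {i : Fin N}
    (huv : HasWeakPartial univ i u v) (ρ : ContDiffBump (0 : EuclideanSpace ℝ (Fin N))) :
    ContDiff ℝ 1 (fun x => ∫ z, ρ.normed volume z * u (x - z)) ∧
    ∀ x, fderiv ℝ (fun x => ∫ z, ρ.normed volume z * u (x - z)) x (EuclideanSpace.single i 1) =
      ∫ z, ρ.normed volume z * v (x - z) := by
  have hu : LocallyIntegrable u volume := locallyIntegrableOn_univ.1 huv.1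
  have hs : ContDiff ℝ 1 (ρ.normed volume) := ρ.contDiff_normed
  have hcs := ρ.hasCompactSupport_normed (μ := volume)
  have e0 : (fun x => ∫ z, ρ.normed volume z * u (x - z)) =
      (ρ.normed volume ⋆[ContinuousLinearMap.mul ℝ ℝ, volume] u) := by
    ext x; rfl
  rw [e0]
  refine ⟨hcs.contDiff_convolution_left _ hs hu, fun x => ?_⟩
  rw [(hcs.hasFDerivAt_convolution_left _ hs hu x).fderiv, convolution_eq_swap]
  have hci : Integrable (fun t => ((ContinuousLinearMap.mul ℝ ℝ).precompL
      (EuclideanSpace ℝ (Fin N))) (fderiv ℝ (ρ.normed volume) (x - t)) (u t)) volume := by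
    have := (hcs.fderiv ℝ).convolutionExists_left
      ((ContinuousLinearMap.mul ℝ ℝ).precompL (EuclideanSpace ℝ (Fin N)))
      (hs.continuous_fderiv one_ne_zero) hu x
    exact this.integrable_swap
  rw [ContinuousLinearMap.integral_apply hci]
  simp only [ContinuousLinearMap.precompL_apply, ContinuousLinearMap.mul_apply']
  have hT : IsTestFunction univ fun y => ρ.normed volume (x - y) :=
    ⟨ρ.contDiff_normed.comp (contDiff_const.sub contDiff_id),
      hcs.comp_homeomorph (Homeomorph.subLeft x), subset_univ _⟩
  have hder : ∀ y, fderiv ℝ (fun y => ρ.normed volume (x - y)) y (EuclideanSpace.single i 1) =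
      - fderiv ℝ (ρ.normed volume) (x - y) (EuclideanSpace.single i 1) := by
    intro y
    have h1 := ((hs.differentiable one_ne_zero (x - y)).hasFDerivAt.comp y
      ((hasFDerivAt_id y).const_sub x)).fderiv
    simp only [Function.comp_def] at h1
    rw [h1]
    simp
  have h := huv.2.2 _ hT
  simp only [hder, Measure.restrict_univ, mul_neg, integral_neg, neg_inj] at h
  have h2 := integral_sub_left_eq_self (fun z => ρ.normed volume z * v (x - z)) volume x
  simp only [sub_sub_cancel] at h2
  rw [← h2]
  simpa only [mul_comm] using h

/-- Morrey's inequality: `W^1_q(ℝ^N) ⊂ L_∞(ℝ^N)` for `q > N`. -/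
theorem exists_eLpNorm_top_le {q : ℝ≥0∞} (hq1 : 1 ≤ q) (hq : (N : ℝ≥0∞) < q) (hq' : q < ∞)
    (hN : 0 < N) :
    ∃ C : ℝ≥0, ∀ (u : EuclideanSpace ℝ (Fin N) → ℝ) (v : Fin N → EuclideanSpace ℝ (Fin N) → ℝ),
      Measurable u → (∀ i, Measurable (v i)) → (∀ i, HasWeakPartial univ i u (v i)) →
      eLpNorm u ∞ volume ≤ C * (eLpNorm u q volume + ∑ i, eLpNorm (v i) q volume) := by
  have hNq : (N : ℝ) < q.toReal := by
    simpa using (ENNReal.toReal_lt_toReal (ENNReal.natCast_ne_top N) hq'.ne).2 hq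
  have hQ0 : 0 < q.toReal := lt_of_le_of_lt (Nat.cast_nonneg N) hNq
  have hQ : 1 ≤ q.toReal := by
    simpa using (ENNReal.toReal_le_toReal ENNReal.one_ne_top hq'.ne).2 hq1
  set m := volume (Metric.ball (0 : EuclideanSpace ℝ (Fin N)) 1) with hm
  have hm0 : m ≠ 0 := (Metric.measure_ball_pos _ _ one_pos).ne'
  have hmt : m ≠ ∞ := measure_ball_lt_top.ne
  set κ := m ^ (1 - 1 / q.toReal) with hκ
  have hκt : κ ≠ ∞ := (ENNReal.rpow_lt_top_of_nonneg
    (sub_nonneg.2 ((div_le_one hQ0).2 hQ)) hmt).ne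
  set D := ∫⁻ s in Ioc (0 : ℝ) 1, ENNReal.ofReal (s ^ (-((N : ℝ) / q.toReal))) with hD
  have hDt : D ≠ ∞ := by
    have h1 : IntervalIntegrable (fun s : ℝ => s ^ (-((N : ℝ) / q.toReal))) volume 0 1 :=
      intervalIntegral.intervalIntegrable_rpow'
        (by rw [neg_lt_neg_iff]; exact (div_lt_one hQ0).2 hNq)
    exact ((intervalIntegrable_iff_integrableOn_Ioc_of_le zero_le_one).1 h1).lintegral_lt_top.ne
  refine ⟨(m⁻¹ * κ * (1 + D)).toNNReal, fun u v hu hv huv => ?_⟩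
  rw [ENNReal.coe_toNNReal (ENNReal.mul_ne_top (ENNReal.mul_ne_top
    (ENNReal.inv_ne_top.2 hm0) hκt) (by finiteness))]
  set A := eLpNorm u q volume with hA
  set S := ∑ i, eLpNorm (v i) q volume with hS
  -- The bound is uniform in the mollifier and in x, so it survives the almost everywhere limit.
  have bound : ∀ (ρ : ContDiffBump (0 : EuclideanSpace ℝ (Fin N))) x,
      ‖∫ z, ρ.normed volume z * u (x - z)‖ₑ ≤ m⁻¹ * κ * (1 + D) * (A + S) := by
    intro ρ x
    have hw := (fderiv_mollifier_of_hasWeakPartial (huv ⟨0, hN⟩) ρ).1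
    have h1 := enorm_mul_volume_ball_le hw x
    have h2 : ∫⁻ y in Metric.ball 0 1, ‖∫ z, ρ.normed volume z * u (x + y - z)‖ₑ ≤ κ * A := by
      have := lintegral_ball_mollifier_le hq1 hq' hu ρ x one_pos
      simp only [one_smul, Real.one_rpow, ENNReal.ofReal_one, mul_one] at this
      exact this
    have h3 : ∀ i, ∫⁻ s in Ioc (0 : ℝ) 1, ∫⁻ y in Metric.ball 0 1,
        ‖fderiv ℝ (fun x => ∫ z, ρ.normed volume z * u (x - z)) (x + s • y)
          (EuclideanSpace.single i 1)‖ₑ ≤ κ * D * eLpNorm (v i) q volume := by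
      intro i
      calc _ ≤ ∫⁻ s in Ioc (0 : ℝ) 1,
            κ * ENNReal.ofReal (s ^ (-((N : ℝ) / q.toReal))) * eLpNorm (v i) q volume := by
            refine setLIntegral_mono' measurableSet_Ioc fun s hs => ?_
            simp only [(fderiv_mollifier_of_hasWeakPartial (huv i) ρ).2]
            exact lintegral_ball_mollifier_le hq1 hq' (hv i) ρ x hs.1
        _ = _ := by
            rw [lintegral_mul_const _ (by fun_prop), lintegral_const_mul _ (by fun_prop)]
    have h4 : ‖∫ z, ρ.normed volume z * u (x - z)‖ₑ * m ≤ κ * (1 + D) * (A + S) := by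
      refine h1.trans ?_
      calc _ ≤ κ * A + ∑ i, κ * D * eLpNorm (v i) q volume :=
            add_le_add h2 (Finset.sum_le_sum fun i _ => h3 i)
        _ = κ * A + κ * D * S := by rw [← Finset.mul_sum]
        _ ≤ κ * A + κ * D * S + (κ * S + κ * D * A) := le_self_add
        _ = _ := by ring
    calc _ = ‖∫ z, ρ.normed volume z * u (x - z)‖ₑ * m * m⁻¹ := by
          rw [mul_assoc, ENNReal.mul_inv_cancel hm0 hmt, mul_one]
      _ ≤ κ * (1 + D) * (A + S) * m⁻¹ := by gcongr
      _ = _ := by ring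
  set ρ : ℕ → ContDiffBump (0 : EuclideanSpace ℝ (Fin N)) := fun n =>
    ⟨1 / (n + 1) / 2, 1 / (n + 1), by positivity, half_lt_self (by positivity)⟩ with hρdef
  have hρ : Tendsto (fun n => (ρ n).rOut) atTop (𝓝 0) := tendsto_one_div_add_atTop_nhds_zero_nat
  have hconv := ContDiffBump.ae_convolution_tendsto_right_of_locallyIntegrable (μ := volume)
    (φ := ρ) hρ (K := 2) (Eventually.of_forall fun n => by simp only [hρdef]; linarith)
    (locallyIntegrableOn_univ.1 (huv ⟨0, hN⟩).1)
  rw [eLpNorm_exponent_top]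
  refine essSup_le_of_ae_le _ ?_
  filter_upwards [hconv] with x hx
  refine le_of_tendsto hx.enorm (Eventually.of_forall fun n => ?_)
  exact bound (ρ n) x

end Morrey

/-! ### Calculus of weak derivatives and the normed space W^1_q -/

section SobolevSpace

variable {N : ℕ} {D : Set (EuclideanSpace ℝ (Fin N))} {i : Fin N}
  {u v u' v' : EuclideanSpace ℝ (Fin N) → ℝ}

theorem LocallyIntegrableOn.integrableOn_mul_of_tsupport_subset {ψ : EuclideanSpace ℝ (Fin N) → ℝ}
    (hu : LocallyIntegrableOn u D volume) (hψ : Continuous ψ) (hc : HasCompactSupport ψ)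
    (hs : tsupport ψ ⊆ D) : IntegrableOn (fun x => u x * ψ x) D volume := by
  have h1 : IntegrableOn u (tsupport ψ) volume := hu.integrableOn_compact_subset hs hc
  obtain ⟨C, hC⟩ := hc.exists_bound_of_continuous hψ
  have h2 : IntegrableOn (fun x => u x * ψ x) (tsupport ψ) volume :=
    h1.mul_bdd (c := C) hψ.aestronglyMeasurable (ae_of_all _ hC)
  refine ((integrableOn_iff_integrable_of_support_subset fun x hx => ?_).1 h2).integrableOn
  exact subset_tsupport ψ (right_ne_zero_of_mul hx)

theorem IsTestFunction.fderiv_apply_prop {φ : EuclideanSpace ℝ (Fin N) → ℝ}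
    (hφ : IsTestFunction D φ) (e : EuclideanSpace ℝ (Fin N)) :
    Continuous (fun x => fderiv ℝ φ x e) ∧ HasCompactSupport (fun x => fderiv ℝ φ x e) ∧
      tsupport (fun x => fderiv ℝ φ x e) ⊆ D :=
  ⟨(hφ.1.continuous_fderiv (by simp)).clm_apply continuous_const, hφ.2.1.fderiv_apply ℝ e,
    (tsupport_fderiv_apply_subset ℝ e).trans hφ.2.2⟩

theorem HasWeakPartial.add (h : HasWeakPartial D i u v) (h' : HasWeakPartial D i u' v') :
    HasWeakPartial D i (u + u') (v + v') := by
  refine ⟨h.1.add h'.1, h.2.1.add h'.2.1, fun φ hφ => ?_⟩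
  obtain ⟨c1, c2, c3⟩ := hφ.fderiv_apply_prop (EuclideanSpace.single i 1)
  simp only [Pi.add_apply, add_mul]
  rw [integral_add (LocallyIntegrableOn.integrableOn_mul_of_tsupport_subset h.1 c1 c2 c3)
    (LocallyIntegrableOn.integrableOn_mul_of_tsupport_subset h'.1 c1 c2 c3),
    integral_add (LocallyIntegrableOn.integrableOn_mul_of_tsupport_subset h.2.1
      hφ.1.continuous hφ.2.1 hφ.2.2)
    (LocallyIntegrableOn.integrableOn_mul_of_tsupport_subset h'.2.1
      hφ.1.continuous hφ.2.1 hφ.2.2), h.2.2 φ hφ, h'.2.2 φ hφ, neg_add]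

theorem HasWeakPartial.const_smul (h : HasWeakPartial D i u v) (c : ℝ) :
    HasWeakPartial D i (c • u) (c • v) := by
  refine ⟨h.1.smul c, h.2.1.smul c, fun φ hφ => ?_⟩
  simp only [Pi.smul_apply, smul_eq_mul, mul_assoc, integral_const_mul, h.2.2 φ hφ, mul_neg]

theorem HasWeakPartial.congr_ae (h : HasWeakPartial D i u v)
    (hu : u =ᵐ[volume.restrict D] u') (hv : v =ᵐ[volume.restrict D] v') :
    HasWeakPartial D i u' v' := by
  refine ⟨h.1.congr hu, h.2.1.congr hv, fun φ hφ => ?_⟩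
  have e1 : ∫ x in D, u' x * fderiv ℝ φ x (EuclideanSpace.single i 1) =
      ∫ x in D, u x * fderiv ℝ φ x (EuclideanSpace.single i 1) :=
    integral_congr_ae (by filter_upwards [hu] with x hx; rw [hx])
  have e2 : ∫ x in D, v' x * φ x = ∫ x in D, v x * φ x :=
    integral_congr_ae (by filter_upwards [hv] with x hx; rw [hx])
  rw [e1, e2, h.2.2 φ hφ]

theorem memLp_locallyIntegrableOn {q : ℝ≥0∞} (hq : 1 ≤ q)
    (hu : MemLp u q (volume.restrict D)) : LocallyIntegrableOn u D volume :=
  locallyIntegrableOn_of_locallyIntegrable_restrict (hu.locallyIntegrable hq)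

theorem hasWeakPartial_of_contDiff (hu : ContDiff ℝ 1 u) :
    HasWeakPartial D i u (fun x => fderiv ℝ u x (EuclideanSpace.single i 1)) := by
  have hc : Continuous fun x => fderiv ℝ u x (EuclideanSpace.single i 1) :=
    (hu.continuous_fderiv one_ne_zero).clm_apply continuous_const
  refine ⟨hu.continuous.locallyIntegrable.locallyIntegrableOn D,
    hc.locallyIntegrable.locallyIntegrableOn D, fun φ hφ => ?_⟩
  obtain ⟨c1, c2, c3⟩ := hφ.fderiv_apply_prop (EuclideanSpace.single i 1)
  rw [setIntegral_eq_integral_of_forall_compl_eq_zero, setIntegral_eq_integral_of_forall_compl_eq_zero]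
  · refine integral_mul_fderiv_eq_neg_fderiv_mul_of_integrable ?_ ?_ ?_ ?_ ?_
    · exact (hc.mul hφ.1.continuous).integrable_of_hasCompactSupport hφ.2.1.mul_left
    · exact (hu.continuous.mul c1).integrable_of_hasCompactSupport c2.mul_left
    · exact (hu.continuous.mul hφ.1.continuous).integrable_of_hasCompactSupport hφ.2.1.mul_left
    · exact fun x _ => hu.differentiable one_ne_zero x
    · exact fun x _ => hφ.1.differentiable (by simp) x
  · intro x hx
    rw [image_eq_zero_of_notMem_tsupport (f := φ) fun h => hx (hφ.2.2 h), mul_zero]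
  · intro x hx
    have := image_eq_zero_of_notMem_tsupport
      (f := fun x => fderiv ℝ φ x (EuclideanSpace.single i 1)) fun h => hx (c3 h)
    rw [this, mul_zero]

/-- For q ≥ 2 all four functions are locally in L_2, so the products are locally integrable and
`weak_product_rule` applies to scalar multiplication with every exponent equal to 2. -/
theorem HasWeakPartial.mul {q : ℝ≥0∞} (hq : 2 ≤ q) (hD : IsOpen D)
    (h : HasWeakPartial D i u v) (h' : HasWeakPartial D i u' v')
    (hu : MemLp u q (volume.restrict D)) (hv : MemLp v q (volume.restrict D))
    (hu' : MemLp u' q (volume.restrict D)) (hv' : MemLp v' q (volume.restrict D)) :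
    HasWeakPartial D i (u * u') (v * u' + u * v') := by
  have mem : ∀ {w : EuclideanSpace ℝ (Fin N) → ℝ}, MemLp w q (volume.restrict D) →
      ∀ S ⊆ D, IsCompact S → MemLp w 2 (volume.restrict S) := fun hw S hS hc => by
    have : IsFiniteMeasure (volume.restrict S) := ⟨by simpa using hc.measure_lt_top⟩
    exact (hw.mono_measure (Measure.restrict_mono hS le_rfl)).mono_exponent hq
  have prod : ∀ {w w' : EuclideanSpace ℝ (Fin N) → ℝ}, MemLp w q (volume.restrict D) →
      MemLp w' q (volume.restrict D) → LocallyIntegrableOn (w * w') D volume := fun hw hw' => by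
    rw [locallyIntegrableOn_iff hD.isLocallyClosed]
    intro S hS hc
    exact (mem hw S hS hc).integrable_mul (mem hw' S hS hc)
  refine ⟨prod hu hu', (prod hv hu').add (prod hu hv'), fun φ hφ => ?_⟩
  have h22 : (2 : ℝ≥0∞).HolderConjugate 2 := inferInstance
  have key := weak_product_rule (μ := volume) (ContinuousLinearMap.id ℝ ℝ)
    (ContinuousLinearMap.id ℝ ℝ) (ContinuousLinearMap.mul ℝ ℝ) (ContinuousLinearMap.mul ℝ ℝ)
    (fun _ _ => rfl) hD (EuclideanSpace.single i 1) h22 h22 h22 (f := u) (f' := v) (g := u')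
    (g' := v') (mem hu) (mem hv') (mem hv) (mem hu') (mem hu) (mem hu')
    (fun φ hφ => by simpa [mul_comm] using h.2.2 φ hφ)
    (fun φ hφ => by simpa [mul_comm] using h'.2.2 φ hφ) hφ
  simpa [mul_comm] using key

/-- The space `W^1_q(Ω)`, embedded into `L_q(Ω)^{1 + N}` by `u ↦ (u, ∇u)`. -/
def sobolevSubmodule (Ω : Set (EuclideanSpace ℝ (Fin N))) (q : ℝ≥0∞) [Fact (1 ≤ q)] :
    Submodule ℝ (Lp ℝ q (volume.restrict Ω) × (Fin N → Lp ℝ q (volume.restrict Ω))) where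
  carrier := {w | ∀ i, HasWeakPartial Ω i w.1 (w.2 i)}
  zero_mem' i := by
    have h : HasWeakPartial Ω i (0 : EuclideanSpace ℝ (Fin N) → ℝ) 0 :=
      ⟨locallyIntegrableOn_zero, locallyIntegrableOn_zero, fun φ _ => by simp⟩
    exact h.congr_ae (Lp.coeFn_zero ℝ q _).symm (Lp.coeFn_zero ℝ q _).symm
  add_mem' {a b} ha hb i :=
    ((ha i).add (hb i)).congr_ae (Lp.coeFn_add _ _).symm (Lp.coeFn_add _ _).symm
  smul_mem' c a ha i :=
    ((ha i).const_smul c).congr_ae (Lp.coeFn_smul _ _).symm (Lp.coeFn_smul _ _).symm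

variable {Ω : Set (EuclideanSpace ℝ (Fin N))} {q : ℝ≥0∞} [Fact (1 ≤ q)]

variable (Ω q) in
/-- The normed space `W^1_q(Ω)`. -/
def SobolevSpace : Type := sobolevSubmodule Ω q

instance : NormedAddCommGroup (SobolevSpace Ω q) :=
  inferInstanceAs (NormedAddCommGroup (sobolevSubmodule Ω q))

instance : NormedSpace ℝ (SobolevSpace Ω q) :=
  inferInstanceAs (NormedSpace ℝ (sobolevSubmodule Ω q))

/-- The element of `W^1_q(Ω)` with a given function and gradient. -/
def SobolevSpace.mk (w : Lp ℝ q (volume.restrict Ω) × (Fin N → Lp ℝ q (volume.restrict Ω)))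
    (hw : w ∈ sobolevSubmodule Ω q) : SobolevSpace Ω q := ⟨w, hw⟩

variable (Ω q) in
/-- The inclusion `W^1_q(Ω) → L_q(Ω)`. -/
def sobolevInclusion : SobolevSpace Ω q →L[ℝ] Lp ℝ q (volume.restrict Ω) :=
  (ContinuousLinearMap.fst ℝ _ _).comp (sobolevSubmodule Ω q).subtypeL

variable (Ω q) in
/-- The partial derivative `∂ᵢ : W^1_q(Ω) → L_q(Ω)`. -/
def sobolevPartial (i : Fin N) : SobolevSpace Ω q →L[ℝ] Lp ℝ q (volume.restrict Ω) :=
  ((ContinuousLinearMap.proj i).comp (ContinuousLinearMap.snd ℝ _ _)).comp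
    (sobolevSubmodule Ω q).subtypeL

theorem hasWeakPartial_sobolev (w : SobolevSpace Ω q) (i : Fin N) :
    HasWeakPartial Ω i (sobolevInclusion Ω q w) (sobolevPartial Ω q i w) := w.2 i

theorem norm_sobolev_le (w : SobolevSpace Ω q) :
    ‖w‖ ≤ ‖sobolevInclusion Ω q w‖ + ∑ i, ‖sobolevPartial Ω q i w‖ := by
  change ‖(w.1 : Lp ℝ q (volume.restrict Ω) × (Fin N → Lp ℝ q (volume.restrict Ω)))‖ ≤ _
  rw [Prod.norm_def]
  refine max_le (le_add_of_nonneg_right (Finset.sum_nonneg fun i _ => norm_nonneg _)) ?_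
  refine (pi_norm_le_iff_of_nonneg (add_nonneg (norm_nonneg _)
    (Finset.sum_nonneg fun i _ => norm_nonneg _))).2 fun i => ?_
  exact (Finset.single_le_sum (f := fun i => ‖sobolevPartial Ω q i w‖)
    (fun i _ => norm_nonneg _) (Finset.mem_univ i)).trans
    (le_add_of_nonneg_left (norm_nonneg _))

/-- Smooth compactly supported functions on ℝ^N, restricted to Ω, are dense in L_q(Ω), and their
classical gradients are weak gradients. -/
theorem denseRange_sobolevInclusion (hq' : q < ∞) : DenseRange (sobolevInclusion Ω q) := by
  refine (Lp.dense_hasCompactSupport_contDiff (F := ℝ) (μ := volume.restrict Ω) hq'.ne).mono ?_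
  rintro f ⟨g, hfg, hc, hs⟩
  have hs1 : ContDiff ℝ 1 g := hs.of_le (by simp)
  have hg : MemLp g q (volume.restrict Ω) := hs.continuous.memLp_of_hasCompactSupport hc
  have hg' : ∀ i : Fin N, MemLp (fun x => fderiv ℝ g x (EuclideanSpace.single i 1)) q
      (volume.restrict Ω) := fun i =>
    ((hs1.continuous_fderiv one_ne_zero).clm_apply continuous_const).memLp_of_hasCompactSupport
      (hc.fderiv_apply ℝ _)
  refine ⟨.mk (f, fun i => (hg' i).toLp _) fun i => ?_, rfl⟩
  exact (hasWeakPartial_of_contDiff hs1).congr_ae hfg.symm (hg' i).coeFn_toLp.symm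

theorem sobolevInclusion_mk (w) (hw : w ∈ sobolevSubmodule Ω q) :
    sobolevInclusion Ω q (.mk w hw) = w.1 := rfl

theorem sobolevPartial_mk (w) (hw : w ∈ sobolevSubmodule Ω q) (i : Fin N) :
    sobolevPartial Ω q i (.mk w hw) = w.2 i := rfl

theorem norm_sobolevInclusion_le (w : SobolevSpace Ω q) : ‖sobolevInclusion Ω q w‖ ≤ ‖w‖ :=
  norm_fst_le (w.1 : Lp ℝ q (volume.restrict Ω) × (Fin N → Lp ℝ q (volume.restrict Ω)))

theorem norm_sobolevPartial_le (w : SobolevSpace Ω q) (i : Fin N) :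
    ‖sobolevPartial Ω q i w‖ ≤ ‖w‖ :=
  (norm_le_pi_norm (w.1 : Lp ℝ q (volume.restrict Ω) × (Fin N → Lp ℝ q (volume.restrict Ω))).2
    i).trans (norm_snd_le _)

attribute [irreducible] sobolevInclusion sobolevPartial

end SobolevSpace

/-! ### The embedding of W^1_q(Ω) into L_∞(Ω) -/

section Embedding

variable {N : ℕ} {q : ℝ≥0∞} {Ω : Set (EuclideanSpace ℝ (Fin N))}
  {ι : (EuclideanSpace ℝ (Fin N) →ₘ[volume.restrict Ω] ℝ) →
    (EuclideanSpace ℝ (Fin N) →ₘ[volume] ℝ)}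

theorem sobolevNorm_zero_eq {D : Set (EuclideanSpace ℝ (Fin N))}
    {u : EuclideanSpace ℝ (Fin N) → ℝ} (hu : AEStronglyMeasurable u (volume.restrict D)) :
    sobolevNorm D q 0 u = eLpNorm u q (volume.restrict D) := by
  simp [sobolevNorm, hu]

theorem HasWeakPartial.aestronglyMeasurable {D : Set (EuclideanSpace ℝ (Fin N))} {i : Fin N}
    {u v : EuclideanSpace ℝ (Fin N) → ℝ} (h : HasWeakPartial D i u v) :
    AEStronglyMeasurable v (volume.restrict D) := h.2.1.aestronglyMeasurable

theorem exists_eLpNorm_top_le_sobolevNorm (hN : 0 < N) (hq1 : 1 ≤ q) (hq : (N : ℝ≥0∞) < q)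
    (hq' : q < ∞) :
    ∃ C : ℝ≥0, ∀ w : EuclideanSpace ℝ (Fin N) → ℝ, AEStronglyMeasurable w volume →
      eLpNorm w ∞ volume ≤ C * sobolevNorm univ q 1 w := by
  obtain ⟨C, hC⟩ := exists_eLpNorm_top_le hq1 hq hq' hN
  -- The constant is made nonzero so that the inequality can be divided by it and rearranged into a
  -- lower bound for the infimum over all gradients.
  refine ⟨C + 1, fun w hw => ?_⟩
  have key : ∀ G : Fin N → EuclideanSpace ℝ (Fin N) → ℝ,
      (∀ i, HasWeakPartial univ i w (G i)) →
      eLpNorm w ∞ volume ≤ C * (eLpNorm w q volume + ∑ i, eLpNorm (G i) q volume) := by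
    intro G hG
    have hGm : ∀ i, AEStronglyMeasurable (G i) volume := fun i => by
      simpa using (hG i).aestronglyMeasurable
    have h := hC (hw.mk w) (fun i => (hGm i).mk (G i)) hw.stronglyMeasurable_mk.measurable
      (fun i => (hGm i).stronglyMeasurable_mk.measurable)
      (fun i => (hG i).congr_ae (by simpa using hw.ae_eq_mk) (by simpa using (hGm i).ae_eq_mk))
    rw [eLpNorm_congr_ae hw.ae_eq_mk, eLpNorm_congr_ae (p := q) hw.ae_eq_mk]
    refine h.trans_eq ?_
    congr 2
    exact Finset.sum_congr rfl fun i _ => (eLpNorm_congr_ae (hGm i).ae_eq_mk).symm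
  have hC0 : ((C + 1 : ℝ≥0) : ℝ≥0∞) ≠ 0 := by simp
  have hs : sobolevNorm univ q 1 w = eLpNorm w q volume +
      ⨅ (G : Fin N → EuclideanSpace ℝ (Fin N) → ℝ) (_ : ∀ i, HasWeakPartial univ i w (G i)),
        ∑ i, sobolevNorm univ q 0 (G i) := by
    rw [sobolevNorm, sobolevNorm_zero_eq (by simpa using hw), Measure.restrict_univ]
  rw [hs, ← ENNReal.div_le_iff' hC0 ENNReal.coe_ne_top, ← tsub_le_iff_left]
  refine le_iInf₂ fun G hG => ?_
  rw [tsub_le_iff_left, ENNReal.div_le_iff' hC0 ENNReal.coe_ne_top]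
  refine (key G hG).trans ?_
  gcongr with i
  · simp
  · rw [sobolevNorm_zero_eq (hG i).aestronglyMeasurable, Measure.restrict_univ]

theorem sobolevNorm_one_le_of_hasWeakPartial {D : Set (EuclideanSpace ℝ (Fin N))}
    {u : EuclideanSpace ℝ (Fin N) → ℝ} {G : Fin N → EuclideanSpace ℝ (Fin N) → ℝ}
    (hu : AEStronglyMeasurable u (volume.restrict D)) (hG : ∀ i, HasWeakPartial D i u (G i)) :
    sobolevNorm D q 1 u ≤
      eLpNorm u q (volume.restrict D) + ∑ i, eLpNorm (G i) q (volume.restrict D) := by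
  rw [sobolevNorm, sobolevNorm_zero_eq hu]
  gcongr
  refine (iInf₂_le G hG).trans_eq ?_
  exact Finset.sum_congr rfl fun i _ => sobolevNorm_zero_eq (hG i).aestronglyMeasurable

variable [Fact (1 ≤ q)]

theorem sobolevNorm_one_le (w : SobolevSpace Ω q) :
    sobolevNorm Ω q 1 (sobolevInclusion Ω q w) ≤ ((N + 1 : ℝ≥0) : ℝ≥0∞) * ‖w‖ₑ := by
  refine (sobolevNorm_one_le_of_hasWeakPartial (Lp.aestronglyMeasurable _)
    (hasWeakPartial_sobolev w)).trans ?_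
  simp only [← Lp.enorm_def]
  have h1 : ‖sobolevInclusion Ω q w‖ₑ ≤ ‖w‖ₑ := enorm_le_iff_norm_le.2 (norm_sobolevInclusion_le w)
  have h2 : ∑ i, ‖sobolevPartial Ω q i w‖ₑ ≤ N * ‖w‖ₑ := by
    refine (Finset.sum_le_card_nsmul _ _ _ fun i _ =>
      enorm_le_iff_norm_le.2 (norm_sobolevPartial_le w i)).trans_eq ?_
    simp
  calc _ ≤ ‖w‖ₑ + N * ‖w‖ₑ := add_le_add h1 h2
    _ = _ := by push_cast; ring

theorem sobolevNorm_one_lt_top (w : SobolevSpace Ω q) :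
    sobolevNorm Ω q 1 (sobolevInclusion Ω q w) < ∞ :=
  (sobolevNorm_one_le w).trans_lt (ENNReal.mul_lt_top ENNReal.coe_lt_top enorm_lt_top)

/-- Extend by ι, apply Morrey's inequality on ℝ^N, and restrict to Ω, where ι w = w. -/
theorem IsExtensionMap.exists_eLpNorm_top_le (hι : IsExtensionMap Ω ι) (hN : 0 < N)
    (hq : (N : ℝ≥0∞) < q) (hq' : q < ∞) :
    ∃ C : ℝ≥0, ∀ w : SobolevSpace Ω q,
      eLpNorm (sobolevInclusion Ω q w) ∞ (volume.restrict Ω) ≤ C * ‖w‖ₑ := by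
  have hq1 : 1 < q := lt_of_le_of_lt (by exact_mod_cast hN) hq
  obtain ⟨C₁, h₁⟩ := exists_eLpNorm_top_le_sobolevNorm hN hq1.le hq hq'
  obtain ⟨C₂, h₂⟩ := hι.norm_le q hq1 hq'
  refine ⟨C₁ * (C₂ * (N + 1)), fun w => ?_⟩
  have hfin := sobolevNorm_one_lt_top w
  have h₃ : eLpNorm (sobolevInclusion Ω q w) ∞ (volume.restrict Ω) ≤
      eLpNorm (ι (sobolevInclusion Ω q w).1) ∞ volume :=
    (eLpNorm_congr_ae (hι.extends_eq q hq1 hq' (sobolevInclusion Ω q w).1 hfin)).symm.trans_le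
      (eLpNorm_mono_measure _ Measure.restrict_le_self)
  have h₄ := h₁ (ι (sobolevInclusion Ω q w).1) (AEEqFun.aestronglyMeasurable _)
  have h₅ := (h₂ 1 le_rfl (sobolevInclusion Ω q w).1 hfin).trans
    (mul_le_mul_right (sobolevNorm_one_le w) (C₂ : ℝ≥0∞))
  have h₆ : ∀ y : ℝ≥0∞, ((C₁ * (C₂ * (N + 1)) : ℝ≥0) : ℝ≥0∞) * y =
      C₁ * (C₂ * (((N + 1 : ℝ≥0) : ℝ≥0∞) * y)) := fun y => by push_cast; ring
  exact ((h₃.trans h₄).trans (mul_le_mul_right h₅ _)).trans_eq (h₆ _).symm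

/-- The embedding `W^1_q(Ω) → L_∞(Ω)` on domains with an extension map. -/
theorem IsExtensionMap.exists_embedding_top (hι : IsExtensionMap Ω ι) (hN : 0 < N)
    (hq : (N : ℝ≥0∞) < q) (hq' : q < ∞) :
    ∃ J : SobolevSpace Ω q →L[ℝ] Lp ℝ ∞ (volume.restrict Ω),
      ∀ w, J w =ᵐ[volume.restrict Ω] sobolevInclusion Ω q w := by
  obtain ⟨C, hC⟩ := hι.exists_eLpNorm_top_le hN hq hq'
  have hm : ∀ w : SobolevSpace Ω q,
      MemLp (sobolevInclusion Ω q w) ∞ (volume.restrict Ω) := fun w =>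
    ⟨Lp.aestronglyMeasurable _,
      (hC w).trans_lt (ENNReal.mul_lt_top ENNReal.coe_lt_top enorm_lt_top)⟩
  let J : SobolevSpace Ω q →ₗ[ℝ] Lp ℝ ∞ (volume.restrict Ω) :=
    { toFun := fun w => (hm w).toLp _
      map_add' := fun v w => by
        rw [← MemLp.toLp_add]
        refine MemLp.toLp_congr _ _ ?_
        exact (Lp.ext_iff.1 ((sobolevInclusion Ω q).map_add v w)).trans (Lp.coeFn_add _ _)
      map_smul' := fun c w =>
        (MemLp.toLp_congr (hm (c • w)) ((hm w).const_smul c)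
          ((Lp.ext_iff.1 ((sobolevInclusion Ω q).map_smul c w)).trans
            (Lp.coeFn_smul _ _))).trans (MemLp.toLp_const_smul c (hm w)) }
  refine ⟨J.mkContinuous C fun w => ?_, fun w => (hm w).coeFn_toLp⟩
  have h : ‖J w‖ₑ ≤ C * ‖w‖ₑ := by
    rw [Lp.enorm_def]
    exact (eLpNorm_congr_ae (hm w).coeFn_toLp).trans_le (hC w)
  have := ENNReal.toReal_mono (ENNReal.mul_lt_top ENNReal.coe_lt_top enorm_lt_top).ne h
  simpa using this

end Embedding

/-- The bound is in terms of ‖e v‖, so `S₀` factors through `e` and extends by density. -/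
theorem exists_extension_of_denseRange {V H Z : Type*} [NormedAddCommGroup V] [NormedSpace ℝ V]
    [NormedAddCommGroup H] [NormedSpace ℝ H] [NormedAddCommGroup Z] [NormedSpace ℝ Z]
    [CompleteSpace Z] (e : V →L[ℝ] H) (he : DenseRange e) {S₀ : V → Z}
    (hadd : ∀ v w, S₀ (v + w) = S₀ v + S₀ w) (hsmul : ∀ (c : ℝ) w, S₀ (c • w) = c • S₀ w)
    {C : ℝ} (hC : ∀ v, ‖S₀ v‖ ≤ C * ‖e v‖) : ∃ S : H →L[ℝ] Z, ∀ v, S (e v) = S₀ v := by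
  let f : V →ₗ[ℝ] Z := { toFun := S₀, map_add' := hadd, map_smul' := hsmul }
  exact ⟨f.extendOfNorm e.toLinearMap,
    LinearMap.extendOfNorm_eq (f := f) (e := e.toLinearMap) he ⟨C, hC⟩⟩

/-! ### The operators obtained from ι and (1 - Δ)^{-1/2} -/

section BesselOperators

variable {N : ℕ} {q : ℝ≥0∞} {Ω : Set (EuclideanSpace ℝ (Fin N))}
  {ι : (EuclideanSpace ℝ (Fin N) →ₘ[volume.restrict Ω] ℝ) →
    (EuclideanSpace ℝ (Fin N) →ₘ[volume] ℝ)}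

theorem IsExtensionMap.exists_continuousLinearMap (hι : IsExtensionMap Ω ι) {s : ℝ≥0∞}
    [Fact (1 ≤ s)] (hs : 1 < s) (hs' : s < ∞) :
    ∃ E : Lp ℝ s (volume.restrict Ω) →L[ℝ] Lp ℝ s (volume : Measure (EuclideanSpace ℝ (Fin N))),
      ∀ F : Lp ℝ s (volume.restrict Ω),
        (E F : EuclideanSpace ℝ (Fin N) →ₘ[volume] ℝ) = ι F := by
  obtain ⟨C, hC⟩ := hι.norm_le s hs hs'
  have hb : ∀ F : Lp ℝ s (volume.restrict Ω), eLpNorm (ι F.1) s volume ≤ C * ‖F‖ₑ := fun F => by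
    have h0 : sobolevNorm Ω s 0 F.1 = ‖F‖ₑ := by
      rw [sobolevNorm_zero_eq (Lp.aestronglyMeasurable F), Lp.enorm_def]
    have h1 := hC 0 zero_le_one F.1 (h0 ▸ enorm_lt_top)
    rwa [h0, sobolevNorm_zero_eq (by
      simpa using (AEEqFun.aestronglyMeasurable (ι F.1))), Measure.restrict_univ] at h1
  have hl : ∀ F : Lp ℝ s (volume.restrict Ω), LocallyIntegrableOn F.1 Ω volume := fun F =>
    memLp_locallyIntegrableOn hs.le (Lp.memLp F)
  let E : Lp ℝ s (volume.restrict Ω) →ₗ[ℝ] Lp ℝ s (volume : Measure (EuclideanSpace ℝ (Fin N))) :=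
    { toFun := fun F => ⟨ι F.1, Lp.mem_Lp_iff_eLpNorm_lt_top.2
        ((hb F).trans_lt (ENNReal.mul_lt_top ENNReal.coe_lt_top enorm_lt_top))⟩
      map_add' := fun F G => Subtype.ext (hι.map_add F.1 G.1 (hl F) (hl G))
      map_smul' := fun c F => Subtype.ext (hι.map_smul c F.1 (hl F)) }
  refine ⟨E.mkContinuous C fun F => ?_, fun F => rfl⟩
  have h : ‖E F‖ₑ ≤ C * ‖F‖ₑ := by
    rw [Lp.enorm_def]
    exact hb F
  have := ENNReal.toReal_mono (ENNReal.mul_lt_top ENNReal.coe_lt_top enorm_lt_top).ne h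
  simpa using this

theorem exists_besselConvL [Fact (1 ≤ q)] [Fact (1 ≤ q / 2)] (hN : 2 ≤ N)
    (hq : (N : ℝ≥0∞) < q) (hq' : q < ∞) :
    ∃ E : Lp ℝ (q / 2) (volume : Measure (EuclideanSpace ℝ (Fin N))) →L[ℝ]
        Lp ℝ q (volume : Measure (EuclideanSpace ℝ (Fin N))),
      ∀ U, E U =ᵐ[volume] besselConv U := by
  obtain ⟨C, hC⟩ := exists_eLpNorm_besselConv_le hN hq hq'
  have hb : ∀ U : Lp ℝ (q / 2) (volume : Measure (EuclideanSpace ℝ (Fin N))),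
      eLpNorm (besselConv U) q volume ≤ C * ‖U‖ₑ := fun U => by
    rw [Lp.enorm_def]
    exact hC U (Lp.aestronglyMeasurable U)
  have hm : ∀ U : Lp ℝ (q / 2) (volume : Measure (EuclideanSpace ℝ (Fin N))),
      MemLp (besselConv U) q volume := fun U =>
    ⟨aestronglyMeasurable_besselConv (Lp.aestronglyMeasurable U),
      (hb U).trans_lt (ENNReal.mul_lt_top ENNReal.coe_lt_top enorm_lt_top)⟩
  let E : Lp ℝ (q / 2) (volume : Measure (EuclideanSpace ℝ (Fin N))) →ₗ[ℝ]
      Lp ℝ q (volume : Measure (EuclideanSpace ℝ (Fin N))) :=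
    { toFun := fun U => (hm U).toLp _
      map_add' := fun U V => by
        rw [← MemLp.toLp_add]
        refine MemLp.toLp_congr _ _ ?_
        filter_upwards [ae_integrable_besselConv hN hq hq' (Lp.memLp U),
          ae_integrable_besselConv hN hq hq' (Lp.memLp V)] with x hU hV
        rw [Pi.add_apply, besselConv, besselConv, besselConv, ← integral_add hU hV]
        refine integral_congr_ae ?_
        filter_upwards [Lp.coeFn_add U V] with y hy
        rw [hy, Pi.add_apply, mul_add]
      map_smul' := fun c U =>
        (MemLp.toLp_congr (hm (c • U)) ((hm U).const_smul c) (ae_of_all _ fun x => by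
          rw [Pi.smul_apply, besselConv, besselConv, smul_eq_mul, ← integral_const_mul]
          refine integral_congr_ae ?_
          filter_upwards [Lp.coeFn_smul c U] with y hy
          rw [hy, Pi.smul_apply, smul_eq_mul, mul_left_comm])).trans
          (MemLp.toLp_const_smul c (hm U)) }
  refine ⟨E.mkContinuous C fun U => ?_, fun U => (hm U).coeFn_toLp⟩
  have h : ‖E U‖ₑ ≤ C * ‖U‖ₑ := by
    rw [Lp.enorm_def]
    exact (eLpNorm_congr_ae (hm U).coeFn_toLp).trans_le (hb U)
  have := ENNReal.toReal_mono (ENNReal.mul_lt_top ENNReal.coe_lt_top enorm_lt_top).ne h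
  simpa using this

section Uniqueness

variable [Fact (1 ≤ q)] {u u' : EuclideanSpace ℝ (Fin N) →ₘ[volume] ℝ}
  {v v' : Lp ℝ q (volume : Measure (EuclideanSpace ℝ (Fin N)))}

theorem toDistribution_add (v v' : Lp ℝ q (volume : Measure (EuclideanSpace ℝ (Fin N)))) :
    toDistribution (v + v') = toDistribution v + toDistribution v' := by
  have h : Complex.ofRealCLM.compLp (v + v') =
      Complex.ofRealCLM.compLp v + Complex.ofRealCLM.compLp v' :=
    map_add (Complex.ofRealCLM.compLpL q volume) v v'
  rw [toDistribution, toDistribution, toDistribution, h]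
  exact map_add (Lp.toTemperedDistributionCLM ℂ volume q) _ _

theorem toDistribution_smul (c : ℝ) (v : Lp ℝ q (volume : Measure (EuclideanSpace ℝ (Fin N)))) :
    toDistribution (c • v) = (c : ℂ) • toDistribution v := by
  have h : Complex.ofRealCLM.compLp (c • v) = (c : ℂ) • Complex.ofRealCLM.compLp v := by
    refine Lp.ext ?_
    filter_upwards [Complex.ofRealCLM.coeFn_compLp (c • v), Complex.ofRealCLM.coeFn_compLp v,
      Lp.coeFn_smul c v, Lp.coeFn_smul (c : ℂ) (Complex.ofRealCLM.compLp v)] with x h1 h2 h3 h4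
    rw [h1, h4, h3, Pi.smul_apply, Pi.smul_apply, h2]
    simp
  rw [toDistribution, toDistribution, h]
  exact map_smul (Lp.toTemperedDistributionCLM ℂ volume q) _ _

theorem toDistribution_injective :
    Function.Injective (toDistribution (N := N) (q := q)) := by
  intro v v' h
  have h1 : Complex.ofRealCLM.compLp v = Complex.ofRealCLM.compLp v' :=
    LinearMap.ker_eq_bot.1 (Lp.ker_toTemperedDistributionCLM_eq_bot
      (F := ℂ) (μ := (volume : Measure (EuclideanSpace ℝ (Fin N)))) (p := q)) h
  refine Lp.ext ?_
  filter_upwards [Complex.ofRealCLM.coeFn_compLp v, Complex.ofRealCLM.coeFn_compLp v',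
    Lp.ext_iff.1 h1] with x e1 e2 e3
  rw [e1, e2] at e3
  simpa using e3

/-- An L_q function is determined by its tempered distribution. Uniqueness is what makes the values
supplied by (e-2), which are only asserted to exist, depend linearly on the data. -/
theorem IsBesselHalf.unique (h : IsBesselHalf u v) (h' : IsBesselHalf u v') : v = v' := by
  obtain ⟨U, hU, hv⟩ := h
  obtain ⟨U', hU', hv'⟩ := h'
  have : U = U' := Subtype.ext (hU.trans hU'.symm)
  exact toDistribution_injective (by rw [hv, hv', this])

theorem IsBesselHalf.add (h : IsBesselHalf u v) (h' : IsBesselHalf u' v') :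
    IsBesselHalf (u + u') (v + v') := by
  obtain ⟨U, hU, hv⟩ := h
  obtain ⟨U', hU', hv'⟩ := h'
  refine ⟨U + U', by rw [← hU, ← hU']; rfl, ?_⟩
  rw [toDistribution_add, toDistribution_add, map_add, hv, hv']

theorem IsBesselHalf.const_smul (h : IsBesselHalf u v) (c : ℝ) : IsBesselHalf (c • u) (c • v) := by
  obtain ⟨U, hU, hv⟩ := h
  refine ⟨c • U, by rw [← hU]; rfl, ?_⟩
  rw [toDistribution_smul, toDistribution_smul, map_smul, hv]

end Uniqueness

/-- `(1 - Δ)^{-1/2} ι : L_{q/2}(Ω) → L_q(ℝ^N)`. -/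
theorem IsExtensionMap.exists_bessel_extension [Fact (1 ≤ q)] [Fact (1 ≤ q / 2)]
    (hι : IsExtensionMap Ω ι) (hN : 2 ≤ N) (hq : (N : ℝ≥0∞) < q) (hq' : q < ∞) :
    ∃ Λ : Lp ℝ (q / 2) (volume.restrict Ω) →L[ℝ]
        Lp ℝ q (volume : Measure (EuclideanSpace ℝ (Fin N))),
      ∀ (h : Lp ℝ (q / 2) (volume.restrict Ω)) (g : Lp ℝ q (volume.restrict Ω)),
        (h : EuclideanSpace ℝ (Fin N) →ₘ[volume.restrict Ω] ℝ) = g → IsBesselHalf (ι g) (Λ h) := by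
  have h2q : 2 < q := lt_of_le_of_lt (by exact_mod_cast hN) hq
  have hs : 1 < q / 2 := by
    rwa [ENNReal.lt_div_iff_mul_lt (by simp) (by simp), one_mul]
  have hs' : q / 2 < ∞ := ENNReal.div_lt_top hq'.ne (by simp)
  obtain ⟨E₁, hE₁⟩ := hι.exists_continuousLinearMap hs hs'
  obtain ⟨E, hE⟩ := hι.exists_continuousLinearMap (ENNReal.one_lt_two.trans h2q) hq'
  obtain ⟨E₂, hE₂⟩ := exists_besselConvL hN hq hq'
  -- `E₁` and `E` are the same ι on L_{q/2} and on L_q. On a class in both spaces they agree, so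
  -- convolving `E₁ h` computes (1 - Δ)^{-1/2} of the L_q function ι g.
  refine ⟨E₂.comp E₁, fun h g hg => ⟨E g, hE g, ?_⟩⟩
  have he : (E g : EuclideanSpace ℝ (Fin N) →ₘ[volume] ℝ) = E₁ h := by rw [hE, hE₁, hg]
  have hf : (E g : EuclideanSpace ℝ (Fin N) → ℝ) = E₁ h := congrArg _ he
  refine toDistribution_besselConv hN hq hq' (E g) _ ?_ ?_
  · rw [hf]; exact Lp.memLp _
  · rw [hf]; exact hE₂ _

set_option maxHeartbeats 1000000 in
/-- `u ↦ (1 - Δ)^{-1/2} ι (∂ᵢ u)` extends from `W^1_q(Ω)` to a bounded operator on `L_q(Ω)`. -/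
theorem IsExtensionMap.exists_bessel_partial [Fact (1 ≤ q)] (hι : IsExtensionMap Ω ι)
    (hq1 : 1 < q) (hq' : q < ∞) (i : Fin N) :
    ∃ S : Lp ℝ q (volume.restrict Ω) →L[ℝ] Lp ℝ q (volume : Measure (EuclideanSpace ℝ (Fin N))),
      ∀ w : SobolevSpace Ω q,
        IsBesselHalf (ι (sobolevPartial Ω q i w)) (S (sobolevInclusion Ω q w)) := by
  obtain ⟨C, hC⟩ := hι.bessel_grad_le q hq1 hq'
  have hex : ∀ w : SobolevSpace Ω q,
      ∃ v : Lp ℝ q (volume : Measure (EuclideanSpace ℝ (Fin N))),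
        IsBesselHalf (ι (sobolevPartial Ω q i w)) v ∧ ‖v‖ ≤ C * ‖sobolevInclusion Ω q w‖ := by
    intro w
    obtain ⟨v, hv, hv'⟩ := hC (sobolevInclusion Ω q w).1 (sobolevPartial Ω q i w).1 i
      (sobolevNorm_one_lt_top w) (hasWeakPartial_sobolev w i)
    refine ⟨v, hv, ?_⟩
    rw [sobolevNorm_zero_eq (Lp.aestronglyMeasurable _)] at hv'
    have h : ‖v‖ₑ ≤ C * ‖sobolevInclusion Ω q w‖ₑ := by
      rw [Lp.enorm_def (f := sobolevInclusion Ω q w)]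
      exact hv'
    have := ENNReal.toReal_mono (ENNReal.mul_lt_top ENNReal.coe_lt_top enorm_lt_top).ne h
    simpa using this
  -- The values are chosen separately for each w; uniqueness makes the choice linear, and the bound
  -- by the L_q norm of w extends it from the dense image of W^1_q(Ω).
  choose S₀ hS₀ hS₀' using hex
  have hl : ∀ F : Lp ℝ q (volume.restrict Ω), LocallyIntegrableOn F.1 Ω volume := fun F =>
    memLp_locallyIntegrableOn hq1.le (Lp.memLp F)
  have hadd : ∀ v w : SobolevSpace Ω q, S₀ (v + w) = S₀ v + S₀ w := fun v w => by
    have e : ι (sobolevPartial Ω q i (v + w)).1 =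
        ι (sobolevPartial Ω q i v).1 + ι (sobolevPartial Ω q i w).1 :=
      (congrArg (fun F : Lp ℝ q (volume.restrict Ω) => ι F.1)
        ((sobolevPartial Ω q i).map_add v w)).trans (hι.map_add _ _ (hl _) (hl _))
    exact (hS₀ (v + w)).unique (e ▸ (hS₀ v).add (hS₀ w))
  have hsmul : ∀ (c : ℝ) (w : SobolevSpace Ω q), S₀ (c • w) = c • S₀ w := fun c w => by
    have e : ι (sobolevPartial Ω q i (c • w)).1 = c • ι (sobolevPartial Ω q i w).1 :=
      (congrArg (fun F : Lp ℝ q (volume.restrict Ω) => ι F.1)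
        ((sobolevPartial Ω q i).map_smul c w)).trans (hι.map_smul c _ (hl _))
    have h := hS₀ (c • w)
    rw [e] at h
    exact h.unique ((hS₀ w).const_smul c)
  obtain ⟨S, hS⟩ := exists_extension_of_denseRange (sobolevInclusion Ω q)
    (denseRange_sobolevInclusion hq') hadd hsmul hS₀'
  exact ⟨S, fun w => (hS w).symm ▸ hS₀ w⟩

end BesselOperators

/-! ### The two bilinear extensions -/

section Bilinear

theorem exists_bilin_sub {H V K Y Z : Type*} [NormedAddCommGroup H] [NormedSpace ℝ H]
    [NormedAddCommGroup V] [NormedSpace ℝ V] [NormedAddCommGroup K] [NormedSpace ℝ K]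
    [NormedAddCommGroup Y] [NormedSpace ℝ Y] [NormedAddCommGroup Z] [NormedSpace ℝ Z]
    (M₁ : H →L[ℝ] K →L[ℝ] H) (M₂ : H →L[ℝ] H →L[ℝ] Y) (J : V →L[ℝ] K) (P : V →L[ℝ] H)
    (S : H →L[ℝ] Z) (Λ : Y →L[ℝ] Z) :
    ∃ A : H →L[ℝ] V →L[ℝ] Z, ∀ u w, A u w = S (M₁ u (J w)) - Λ (M₂ u (P w)) :=
  ⟨(ContinuousLinearMap.compL ℝ V H Z S).comp (M₁.bilinearComp (.id ℝ H) J) -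
    (ContinuousLinearMap.compL ℝ V Y Z Λ).comp (M₂.bilinearComp (.id ℝ H) P), fun _ _ => rfl⟩

theorem exists_bilin_comp {H V Y Z : Type*} [NormedAddCommGroup H] [NormedSpace ℝ H]
    [NormedAddCommGroup V] [NormedSpace ℝ V]
    [NormedAddCommGroup Y] [NormedSpace ℝ Y] [NormedAddCommGroup Z] [NormedSpace ℝ Z]
    (M : H →L[ℝ] H →L[ℝ] Y) (P : V →L[ℝ] H) (Λ : Y →L[ℝ] Z) :
    ∃ B : V →L[ℝ] H →L[ℝ] Z, ∀ v h, B v h = Λ (M (P v) h) :=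
  ⟨(ContinuousLinearMap.compL ℝ H Y Z Λ).comp (M.comp P), fun _ _ => rfl⟩

variable {N : ℕ} {q : ℝ≥0∞} {Ω : Set (EuclideanSpace ℝ (Fin N))}
  {ι : (EuclideanSpace ℝ (Fin N) →ₘ[volume.restrict Ω] ℝ) →
    (EuclideanSpace ℝ (Fin N) →ₘ[volume] ℝ)}

theorem exists_mul_top [Fact (1 ≤ q)] :
    ∃ M : Lp ℝ q (volume.restrict Ω) →L[ℝ] Lp ℝ ∞ (volume.restrict Ω) →L[ℝ]
        Lp ℝ q (volume.restrict Ω),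
      ∀ u v, ∀ᵐ x ∂volume.restrict Ω, M u v x = u x * v x :=
  ⟨(ContinuousLinearMap.mul ℝ ℝ).holderL (volume.restrict Ω) q ∞ q,
    fun u v => (ContinuousLinearMap.mul ℝ ℝ).coeFn_holder u v⟩

theorem exists_mul_half [Fact (1 ≤ q)] [Fact (1 ≤ q / 2)] :
    ∃ M : Lp ℝ q (volume.restrict Ω) →L[ℝ] Lp ℝ q (volume.restrict Ω) →L[ℝ]
        Lp ℝ (q / 2) (volume.restrict Ω),
      ∀ u v, ∀ᵐ x ∂volume.restrict Ω, M u v x = u x * v x := by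
  have : ENNReal.HolderTriple q q (q / 2) := ⟨by
    rw [ENNReal.inv_div (by simp) (by simp), ← two_mul, div_eq_mul_inv]⟩
  exact ⟨(ContinuousLinearMap.mul ℝ ℝ).holderL (volume.restrict Ω) q q (q / 2),
    fun u v => (ContinuousLinearMap.mul ℝ ℝ).coeFn_holder u v⟩

/-- Writing `J w` for the function w regarded in L_∞ keeps the product and both terms of the Leibniz
rule in L_q, so that W^1_q(Ω) is closed under products. -/
theorem mul_mem_sobolevSubmodule [Fact (1 ≤ q)] (hΩ : IsOpen Ω) (h2 : 2 ≤ q)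
    {J : SobolevSpace Ω q → Lp ℝ ∞ (volume.restrict Ω)}
    (hJ : ∀ w, J w =ᵐ[volume.restrict Ω] sobolevInclusion Ω q w)
    {M : Lp ℝ q (volume.restrict Ω) → Lp ℝ ∞ (volume.restrict Ω) → Lp ℝ q (volume.restrict Ω)}
    (hM : ∀ u v, ∀ᵐ x ∂volume.restrict Ω, M u v x = u x * v x) (v w : SobolevSpace Ω q) :
    (M (sobolevInclusion Ω q v) (J w), fun l => M (sobolevPartial Ω q l v) (J w) +
      M (sobolevPartial Ω q l w) (J v)) ∈ sobolevSubmodule Ω q := by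
  intro l
  refine (HasWeakPartial.mul h2 hΩ (hasWeakPartial_sobolev v l) (hasWeakPartial_sobolev w l)
    (Lp.memLp _) (Lp.memLp _) (Lp.memLp _) (Lp.memLp _)).congr_ae ?_ ?_
  · filter_upwards [hM (sobolevInclusion Ω q v) (J w), hJ w] with x h1 h2
    exact (h1.trans (congrArg _ h2)).symm
  · filter_upwards [hM (sobolevPartial Ω q l v) (J w), hM (sobolevPartial Ω q l w) (J v),
      hJ w, hJ v, Lp.coeFn_add (M (sobolevPartial Ω q l v) (J w))
        (M (sobolevPartial Ω q l w) (J v))] with x h1 h2 h3 h4 h5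
    refine (h5.trans (congrArg₂ (· + ·) (h1.trans (congrArg _ h3)) ?_)).symm
    exact h2.trans ((congrArg _ h4).trans (mul_comm _ _))

set_option maxHeartbeats 1000000 in
/-- The bilinear maps `(u, v) ↦ (1 - Δ)^{-1/2} ι ((∂ᵢ u) v)`, extended to `u ∈ L_q(Ω)`,
`v ∈ W^1_q(Ω)` and to `u ∈ W^1_q(Ω)`, `v ∈ L_q(Ω)`. -/
theorem IsExtensionMap.exists_bilin [Fact (1 ≤ q)] (hι : IsExtensionMap Ω ι) (hΩ : IsOpen Ω)
    (hN : 2 ≤ N) (hq : (N : ℝ≥0∞) < q) (hq' : q < ∞) (i : Fin N) :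
    ∃ (A : Lp ℝ q (volume.restrict Ω) →L[ℝ] SobolevSpace Ω q →L[ℝ]
          Lp ℝ q (volume : Measure (EuclideanSpace ℝ (Fin N))))
      (B : SobolevSpace Ω q →L[ℝ] Lp ℝ q (volume.restrict Ω) →L[ℝ]
          Lp ℝ q (volume : Measure (EuclideanSpace ℝ (Fin N)))) (C : ℝ≥0),
      (∀ v w, B v (sobolevInclusion Ω q w) = A (sobolevInclusion Ω q v) w) ∧
      (∀ v w, IsBesselHalf (ι ((sobolevPartial Ω q i v :
          EuclideanSpace ℝ (Fin N) →ₘ[volume.restrict Ω] ℝ) * sobolevInclusion Ω q w))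
          (B v (sobolevInclusion Ω q w))) ∧
      ∀ v h, ‖B v h‖ ≤ C * (‖sobolevPartial Ω q i v‖ * ‖h‖) := by
  have h2q : 2 < q := lt_of_le_of_lt (by exact_mod_cast hN) hq
  have hq1 : 1 < q := ENNReal.one_lt_two.trans h2q
  have : Fact (1 ≤ q / 2) := ⟨by
    rw [ENNReal.le_div_iff_mul_le (by simp) (by simp), one_mul]; exact h2q.le⟩
  obtain ⟨J, hJ⟩ := hι.exists_embedding_top (by omega) hq hq'
  obtain ⟨M₁, hM₁⟩ := exists_mul_top (q := q) (Ω := Ω)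
  obtain ⟨M₂, hM₂⟩ := exists_mul_half (q := q) (Ω := Ω)
  obtain ⟨Λ, hΛ⟩ := hι.exists_bessel_extension hN hq hq'
  obtain ⟨S, hS⟩ := hι.exists_bessel_partial hq1 hq' i
  -- A(u, w) = S(u w) - Λ(u ∂ᵢw), after (∂ᵢu) w = ∂ᵢ(u w) - u ∂ᵢw; next, B(v, h) = Λ((∂ᵢv) h).
  obtain ⟨A, hA⟩ := exists_bilin_sub M₁ M₂ J (sobolevPartial Ω q i) S Λ
  obtain ⟨B, hB⟩ := exists_bilin_comp M₂ (sobolevPartial Ω q i) Λ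
  -- The same product seen in L_{q/2}, where Λ acts, and in L_q, where `IsBesselHalf` is formulated.
  have hcl : ∀ (u : Lp ℝ q (volume.restrict Ω)) (w : SobolevSpace Ω q),
      (M₂ u (sobolevInclusion Ω q w) : EuclideanSpace ℝ (Fin N) →ₘ[volume.restrict Ω] ℝ) =
        M₁ u (J w) := fun u w => by
    refine AEEqFun.ext ?_
    filter_upwards [hM₂ u (sobolevInclusion Ω q w), hM₁ u (J w), hJ w] with x h1 h2 h3
    exact h1.trans (h2.trans (congrArg _ h3)).symm
  have hmul : ∀ (u : Lp ℝ q (volume.restrict Ω)) (w : SobolevSpace Ω q),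
      (M₁ u (J w) : EuclideanSpace ℝ (Fin N) →ₘ[volume.restrict Ω] ℝ) =
        u * sobolevInclusion Ω q w := fun u w => by
    refine AEEqFun.ext ?_
    filter_upwards [hM₁ u (J w), hJ w, AEEqFun.coeFn_mul
      (u : EuclideanSpace ℝ (Fin N) →ₘ[volume.restrict Ω] ℝ)
      (sobolevInclusion Ω q w : EuclideanSpace ℝ (Fin N) →ₘ[volume.restrict Ω] ℝ)] with x h1 h2 h3
    exact (h1.trans (congrArg _ h2)).trans h3.symm
  have hbess : ∀ (u : Lp ℝ q (volume.restrict Ω)) (w : SobolevSpace Ω q),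
      IsBesselHalf (ι (M₁ u (J w))) (Λ (M₂ u (sobolevInclusion Ω q w))) := fun u w =>
    hΛ _ _ (hcl u w)
  have hl : ∀ F : Lp ℝ q (volume.restrict Ω), LocallyIntegrableOn F.1 Ω volume := fun F =>
    memLp_locallyIntegrableOn hq1.le (Lp.memLp F)
  refine ⟨A, B, ‖Λ‖₊ * ‖M₂‖₊, fun v w => ?_, fun v w => ?_, fun v h => ?_⟩
  -- By the Leibniz rule, S(v w) and Λ((∂ᵢv) w) + Λ((∂ᵢw) v) are both (1 - Δ)^{-1/2} of ι(∂ᵢ(v w));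
  -- uniqueness gives the compatibility of A and B.
  · have hz := hS (.mk _ (mul_mem_sobolevSubmodule hΩ h2q.le hJ hM₁ v w))
    rw [sobolevInclusion_mk, sobolevPartial_mk] at hz
    have e : ι (M₁ (sobolevPartial Ω q i v) (J w) + M₁ (sobolevPartial Ω q i w) (J v) :
        Lp ℝ q (volume.restrict Ω)) = ι (M₁ (sobolevPartial Ω q i v) (J w)) +
          ι (M₁ (sobolevPartial Ω q i w) (J v)) := hι.map_add _ _ (hl _) (hl _)
    have hsum := (hbess (sobolevPartial Ω q i v) w).add (hbess (sobolevPartial Ω q i w) v)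
    rw [← e] at hsum
    have hcomm : M₂ (sobolevPartial Ω q i w) (sobolevInclusion Ω q v) =
        M₂ (sobolevInclusion Ω q v) (sobolevPartial Ω q i w) := by
      refine Lp.ext ?_
      filter_upwards [hM₂ (sobolevPartial Ω q i w) (sobolevInclusion Ω q v),
        hM₂ (sobolevInclusion Ω q v) (sobolevPartial Ω q i w)] with x h1 h2
      exact h1.trans ((mul_comm _ _).trans h2.symm)
    have := hz.unique hsum
    rw [hcomm] at this
    rw [hA, hB, this, add_sub_cancel_right]
  · rw [hB, ← hmul]
    exact hbess _ w
  -- B sees v only through ∂ᵢv, which is why ∇f and not the full norm of f appears in the second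
  -- term of the estimate.
  · rw [hB]
    calc ‖Λ (M₂ (sobolevPartial Ω q i v) h)‖ ≤ ‖Λ‖ * ‖M₂ (sobolevPartial Ω q i v) h‖ :=
          Λ.le_opNorm _
      _ ≤ ‖Λ‖ * (‖M₂‖ * ‖sobolevPartial Ω q i v‖ * ‖h‖) := by
          gcongr
          exact M₂.le_opNorm₂ _ _
      _ = _ := by push_cast; ring

end Bilinear

/-! ### Bilinear expressions of time-dependent functions -/

section TimeDependent

theorem HasWeakTimeDeriv.congr_ae {X : Type*} [NormedAddCommGroup X] [NormedSpace ℝ X] {T : ℝ}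
    {f g f' : ℝ → X} (h : HasWeakTimeDeriv T f f') (hfg : f =ᵐ[volume.restrict (Ioo 0 T)] g) :
    HasWeakTimeDeriv T g f' := by
  refine ⟨h.1.congr hfg, h.2.1, fun φ hφ => ?_⟩
  rw [← h.2.2 φ hφ]
  exact integral_congr_ae (by filter_upwards [hfg] with t ht; rw [ht])

/-- `V` stands for W^1_q(Ω) and `H` for L_q(Ω). Time derivatives exist only in `H`, hence the two
maps. `V` need not be complete, as all vector-valued integrals are taken in `H` and `Z`. -/
theorem hasWeakTimeDeriv_bilin {V H Z : Type*} [NormedAddCommGroup V] [NormedSpace ℝ V]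
    [NormedAddCommGroup H] [NormedSpace ℝ H] [CompleteSpace H] [NormedAddCommGroup Z]
    [NormedSpace ℝ Z] [CompleteSpace Z] (j : V →L[ℝ] H) (B : V →L[ℝ] H →L[ℝ] Z)
    (A : H →L[ℝ] V →L[ℝ] Z) (hAB : ∀ v w, B v (j w) = A (j v) w) {T : ℝ} (hT : 0 < T)
    {a a' b b' : ℝ≥0∞} (haa : a.HolderConjugate a') (hbb : b.HolderConjugate b')
    {f g : ℝ → V} {ft gt : ℝ → H}
    (hf : MemLp f b (volume.restrict (Ioo 0 T))) (hft : MemLp ft a (volume.restrict (Ioo 0 T)))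
    (hg : MemLp g a' (volume.restrict (Ioo 0 T))) (hgt : MemLp gt b' (volume.restrict (Ioo 0 T)))
    (hf' : HasWeakTimeDeriv T (fun t => j (f t)) ft)
    (hg' : HasWeakTimeDeriv T (fun t => j (g t)) gt) :
    HasWeakTimeDeriv T (fun t => B (f t) (j (g t)))
      (fun t => A (ft t) (g t) + B (f t) (gt t)) := by
  have hb1 : 1 ≤ b := ENNReal.HolderConjugate.one_le b b'
  have ha1 : 1 ≤ a := ENNReal.HolderConjugate.one_le a a'
  have hb1' : 1 ≤ b' := ENNReal.HolderConjugate.one_le b' b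
  have ha1' : 1 ≤ a' := ENNReal.HolderConjugate.one_le a' a
  have hf1 : MemLp f 1 (volume.restrict (Ioo 0 T)) := hf.mono_exponent hb1
  have hg1 : MemLp g 1 (volume.restrict (Ioo 0 T)) := hg.mono_exponent ha1'
  have hft1 : Integrable ft (volume.restrict (Ioo 0 T)) := hft.integrable ha1
  have hgt1 : Integrable gt (volume.restrict (Ioo 0 T)) := hgt.integrable hb1'
  -- Boundedness in `H` supplies the pair (∞, 1) for the undifferentiated product, whatever the
  -- exponents a and b are.
  have hjf : MemLp (fun t => j (f t)) ∞ (volume.restrict (Ioo 0 T)) :=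
    hf'.memLp_top hT (memLp_one_iff_integrable.1 (j.comp_memLp' hf1)) hft1
  have hjg : MemLp (fun t => j (g t)) ∞ (volume.restrict (Ioo 0 T)) :=
    hg'.memLp_top hT (memLp_one_iff_integrable.1 (j.comp_memLp' hg1)) hgt1
  have h1top : (1 : ℝ≥0∞).HolderConjugate ∞ := inferInstance
  have htop1 : (∞ : ℝ≥0∞).HolderConjugate 1 := inferInstance
  refine ⟨?_, ?_, fun φ hφ => ?_⟩
  · exact IntegrableOn.locallyIntegrableOn
      (memLp_one_iff_integrable.1 (B.memLp_of_bilin 1 hf1 hjg))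
  · exact IntegrableOn.locallyIntegrableOn
      (memLp_one_iff_integrable.1 ((A.memLp_of_bilin 1 hft hg).add (B.memLp_of_bilin 1 hf hgt)))
  · exact weak_product_rule (μ := volume) j j B A hAB isOpen_Ioo (1 : ℝ) haa hbb htop1
      (fun S hS _ => hf.mono_measure (Measure.restrict_mono hS le_rfl))
      (fun S hS _ => hgt.mono_measure (Measure.restrict_mono hS le_rfl))
      (fun S hS _ => hft.mono_measure (Measure.restrict_mono hS le_rfl))
      (fun S hS _ => hg.mono_measure (Measure.restrict_mono hS le_rfl))
      (fun S hS _ => hjf.mono_measure (Measure.restrict_mono hS le_rfl))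
      (fun S hS _ => hg1.mono_measure (Measure.restrict_mono hS le_rfl))
      hf'.2.2 hg'.2.2 hφ

theorem exists_memLp_submodule {α X : Type*} [MeasurableSpace α] {μ : Measure α}
    [NormedAddCommGroup X] [NormedSpace ℝ X] (V : Submodule ℝ X) {b : ℝ≥0∞} {f : α → X}
    (hf : MemLp f b μ) (hV : ∀ᵐ t ∂μ, f t ∈ V) :
    ∃ F : α → V, MemLp F b μ ∧ ∀ᵐ t ∂μ, (F t : X) = f t := by
  classical
  let F : α → V := fun t => if ht : f t ∈ V then ⟨f t, ht⟩ else 0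
  have hF : ∀ᵐ t ∂μ, (F t : X) = f t := by
    filter_upwards [hV] with t ht
    simp only [F, dif_pos ht]
  have hm : AEStronglyMeasurable F μ :=
    Topology.IsEmbedding.subtypeVal.aestronglyMeasurable_comp_iff.1
      (hf.1.congr (hF.mono fun t ht => ht.symm))
  exact ⟨F, (memLp_congr_norm hm hf.1 (hF.mono fun t ht => congrArg norm ht)).2 hf, hF⟩

variable {N : ℕ} {q : ℝ≥0∞} [Fact (1 ≤ q)] {Ω : Set (EuclideanSpace ℝ (Fin N))}

/-- W^1_q(Ω) carries the norm of L_q(Ω)^{1+N}, so measurability and integrability of (f, ∇f) pass to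
the lift; on the exceptional null set its value is 0. -/
theorem MemBochnerW1.exists_lift {T : ℝ} {b : ℝ≥0∞} {f : ℝ → Lp ℝ q (volume.restrict Ω)}
    {Df : Fin N → ℝ → Lp ℝ q (volume.restrict Ω)} (h : MemBochnerW1 Ω T b f Df) :
    ∃ F : ℝ → SobolevSpace Ω q, MemLp F b (volume.restrict (Ioo 0 T)) ∧
      ∀ᵐ t ∂volume.restrict (Ioo 0 T), sobolevInclusion Ω q (F t) = f t ∧
        ∀ i, sobolevPartial Ω q i (F t) = Df i t := by
  have hp : MemLp (fun t => (f t, fun i => Df i t)) b (volume.restrict (Ioo 0 T)) :=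
    memLp_prod_iff.2 ⟨h.memLp, memLp_pi_iff.2 h.memLp_grad⟩
  obtain ⟨F, hL, hF⟩ := exists_memLp_submodule (sobolevSubmodule Ω q) hp h.grad
  refine ⟨F, hL, hF.mono fun t ht => ⟨?_, fun i => ?_⟩⟩
  · exact (sobolevInclusion_mk _ (F t).2).trans (congrArg Prod.fst ht)
  · exact (sobolevPartial_mk _ (F t).2 i).trans (congrArg (fun w => w.2 i) ht)

end TimeDependent

end FreeBoundary

end

/-! ### The estimate -/

theorem lemma3p3 {N : ℕ} (hN : 2 ≤ N) (p q r : ℝ≥0∞) [Fact (1 ≤ q)]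
    (hp : 1 < p) (hp' : p < ∞) (hq : (N : ℝ≥0∞) < q) (hq' : q < ∞)
    (hr : (N : ℝ≥0∞) < r) (hr' : r < ∞)
    (Ω : Set (EuclideanSpace ℝ (Fin N))) (hΩ : FreeBoundary.IsUniformDomain r Ω)
    (ι : (EuclideanSpace ℝ (Fin N) →ₘ[volume.restrict Ω] ℝ) →
      (EuclideanSpace ℝ (Fin N) →ₘ[volume] ℝ))
    (hι : FreeBoundary.IsExtensionMap Ω ι) :
    ∃ C : ℝ≥0, ∀ (T : ℝ), 0 < T →
      ∀ (a a' b b' : ℝ≥0∞), a.HolderConjugate a' → b.HolderConjugate b' →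
      ∀ (f ft g gt : ℝ → Lp ℝ q (volume.restrict Ω))
        (Df Dg : Fin N → ℝ → Lp ℝ q (volume.restrict Ω)),
      FreeBoundary.MemBochnerW1 Ω T b f Df →
      FreeBoundary.HasWeakTimeDeriv T f ft → MemLp ft a (volume.restrict (Ioo 0 T)) →
      FreeBoundary.MemBochnerW1 Ω T a' g Dg →
      FreeBoundary.HasWeakTimeDeriv T g gt → MemLp gt b' (volume.restrict (Ioo 0 T)) →
      ∃ w wt : Fin N → ℝ → Lp ℝ q (volume : Measure (EuclideanSpace ℝ (Fin N))),
        (∀ᵐ t ∂volume.restrict (Ioo 0 T), ∀ i,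
          FreeBoundary.IsBesselHalf
            (ι ((Df i t : EuclideanSpace ℝ (Fin N) →ₘ[volume.restrict Ω] ℝ) * g t)) (w i t)) ∧
        (∀ i, FreeBoundary.HasWeakTimeDeriv T (w i) (wt i)) ∧
        eLpNorm (fun t => ∑ i, ‖wt i t‖) p (volume.restrict (Ioo 0 T)) ≤
          C * (eLpNorm (fun t => ‖ft t‖ * (‖g t‖ + ∑ i, ‖Dg i t‖)) p
                (volume.restrict (Ioo 0 T)) +
              eLpNorm (fun t => (∑ i, ‖Df i t‖) * ‖gt t‖) p
                (volume.restrict (Ioo 0 T))) := by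
  choose A B C hAB hBess hBC using fun i => hι.exists_bilin hΩ.isOpen hN hq hq' i
  -- The maps A and B and their bounds are fixed before T, the exponents and the functions, so the
  -- constant is uniform in all of these.
  refine ⟨∑ i, (‖A i‖₊ + C i), fun T hT a a' b b' haa hbb f ft g gt Df Dg hf hft hfta hg hgt hgtb =>
    ?_⟩
  obtain ⟨F, hF, hF'⟩ := hf.exists_lift
  obtain ⟨G, hG, hG'⟩ := hg.exists_lift
  refine ⟨fun i t => B i (F t) (FreeBoundary.sobolevInclusion Ω q (G t)),
    fun i t => A i (ft t) (G t) + B i (F t) (gt t), ?_, fun i => ?_, ?_⟩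
  · filter_upwards [hF', hG'] with t htF htG i
    rw [← htF.2 i, ← htG.1]
    exact hBess i (F t) (G t)
  · exact FreeBoundary.hasWeakTimeDeriv_bilin (FreeBoundary.sobolevInclusion Ω q) (B i) (A i)
      (hAB i) hT haa hbb hF hfta hG hgtb (hft.congr_ae (hF'.mono fun t ht => ht.1.symm))
      (hgt.congr_ae (hG'.mono fun t ht => ht.1.symm))
  -- The two constants are merged into one by adding the nonnegative cross terms.
  · have hgen : ∀ {α γ X Y : ℝ}, 0 ≤ α → 0 ≤ γ → 0 ≤ X → 0 ≤ Y →
        α * X + γ * Y ≤ (α + γ) * (X + Y) := fun hα hγ hX hY => by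
      nlinarith [mul_nonneg hα hY, mul_nonneg hγ hX]
    have hbound : ∀ᵐ t ∂volume.restrict (Ioo 0 T),
        ‖∑ i, ‖A i (ft t) (G t) + B i (F t) (gt t)‖‖ ≤
          ((∑ i, (‖A i‖₊ + C i) : ℝ≥0) : ℝ) * ‖‖ft t‖ * (‖g t‖ + ∑ i, ‖Dg i t‖) +
            (∑ i, ‖Df i t‖) * ‖gt t‖‖ := by
      filter_upwards [hF', hG'] with t htF htG
      have hGt : ‖G t‖ ≤ ‖g t‖ + ∑ i, ‖Dg i t‖ := by
        have h := FreeBoundary.norm_sobolev_le (G t)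
        simp only [htG.1, htG.2] at h
        exact h
      have hX : 0 ≤ ‖ft t‖ * (‖g t‖ + ∑ i, ‖Dg i t‖) := by positivity
      have hY : 0 ≤ (∑ i, ‖Df i t‖) * ‖gt t‖ := by positivity
      rw [Real.norm_of_nonneg (by positivity), Real.norm_of_nonneg (add_nonneg hX hY),
        NNReal.coe_sum, Finset.sum_mul]
      refine Finset.sum_le_sum fun i _ => ?_
      have h1 : ‖A i (ft t) (G t)‖ ≤ ‖A i‖ * (‖ft t‖ * (‖g t‖ + ∑ i, ‖Dg i t‖)) := by
        refine ((A i).le_opNorm₂ _ _).trans ?_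
        rw [mul_assoc]
        gcongr
      have h2 : ‖B i (F t) (gt t)‖ ≤ C i * ((∑ i, ‖Df i t‖) * ‖gt t‖) := by
        refine (hBC i _ _).trans ?_
        rw [htF.2 i]
        gcongr
        exact Finset.single_le_sum (f := fun i => ‖Df i t‖) (fun i _ => norm_nonneg _)
          (Finset.mem_univ i)
      refine (norm_add_le _ _).trans ((add_le_add h1 h2).trans ?_)
      exact hgen (A i).opNorm_nonneg (C i).coe_nonneg hX hY
    refine (eLpNorm_le_mul_eLpNorm_of_ae_le_mul hbound p).trans ?_
    rw [ENNReal.ofReal_coe_nnreal]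
    gcongr
    refine eLpNorm_add_le ?_ ?_ hp.le
    · exact hfta.1.norm.mul (hg.memLp.1.norm.add
        (Finset.aestronglyMeasurable_fun_sum _ fun i _ => (hg.memLp_grad i).1.norm))
    · exact (Finset.aestronglyMeasurable_fun_sum _ fun i _ => (hf.memLp_grad i).1.norm).mul
        hgtb.1.norm
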